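/- Let $\mathfrak g$ be a finite-dimensional real Lie algebra and let $M$ be a simply connected (in particular connected and non-empty) smooth Hausdorff finite-dimensional manifold without boundary. Suppose that $\mathfrak g$ acts on $M$, i.e. that a Lie algebra homomorphism $\zeta:\mathfrak g\to\mathfrak X(M)$, $X\mapsto\zeta_X$, into the smooth vector fields is given, and that the action is free and transitive: for each $y\in M$ the map $\mathfrak g\to T_yM$, $X\mapsto \zeta_X(y)$, is injective and surjective. Let $G$ be a Lie group with Lie algebra $\mathfrak g$ (identified with $T_eG$, with the bracket of left invariant vector fields), and for $X\in\mathfrak g$ let $L_X$ be the left invariant vector field on $G$ generated by $X$. A smooth map $f:M\to G$ is called $\mathfrak g$-equivariant if $Tf\circ\zeta_X=L_X\circ f$ for all $X\in\mathfrak g$. For $x\in M$ let $L(x)$ be the leaf through $(e,x)$, i.e. the maximal connected integral manifold through $(e,x)$, of the integrable distribution $\{(L_X(g),\zeta_X(y)) : X\in\mathfrak g\}\subset T_gG\times T_yM$ on $G\times M$, and let $W_x:=\operatorname{pr}_1(L(x))\subset G$. Then for each $x\in M$ the set $W_x$ is open in $G$, and there is a $\mathfrak g$-equivariant smooth map $C_x:M\to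 W_x\subset G$ with $C_x(x)=e$ which is a local diffeomorphism; it is the unique $\mathfrak g$-equivariant smooth map $M\to G$ sending $x$ to $e$. If moreover the $\mathfrak g$-action integrates to a $G$-action, i.e. if there is a smooth right action $M\times G\to M$ whose fundamental vector fields are the $\zeta_X$ (that is, $\zeta_X(y)$ is the derivative of $g\mapsto y\cdot g$ at $e$ in the direction $X$), then $C_x$ is a diffeomorphism from $M$ onto $W_x$, and $W_x=G$ if $G$ is connected. -/

import Mathlib

open scoped Manifold ContDiff

universe w

/-- A real smooth Lie group is regular enough for Mathlib to put a Lie algebra structure on its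
tangent space `GroupLieAlgebra I G` at the identity. -/
instance instLieGroupMinSmoothnessThree {F H : Type*} [NormedAddCommGroup F] [NormedSpace ℝ F]
    [TopologicalSpace H] {I : ModelWithCorners ℝ F H} {G : Type*} [TopologicalSpace G]
    [ChartedSpace H G] [Group G] [LieGroup I ∞ G] : LieGroup I (minSmoothness ℝ 3) G :=
  LieGroup.of_le (n := ∞) (by
    rw [minSmoothness_of_isRCLikeNormedField]
    exact ENat.LEInfty.out)

/-- An action of the real Lie algebra `𝔤` on the smooth manifold `M` (modelled on `E`): a
homomorphism `X ↦ ζ_X` of Lie algebras from `𝔤` to the smooth vector fields on `M`. -/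
structure LieAlgebraAction (𝔤 : Type*) [LieRing 𝔤] [LieAlgebra ℝ 𝔤]
    (E : Type*) [NormedAddCommGroup E] [NormedSpace ℝ E]
    (M : Type*) [TopologicalSpace M] [ChartedSpace E M] [IsManifold 𝓘(ℝ, E) ∞ M] where
  /-- The fundamental vector fields `ζ_X`. -/
  field : 𝔤 →ₗ[ℝ] (Π y : M, TangentSpace 𝓘(ℝ, E) y)
  smooth : ∀ X : 𝔤, ContMDiff 𝓘(ℝ, E) 𝓘(ℝ, E).tangent ∞
    (fun y : M ↦ (⟨y, field X y⟩ : TangentBundle 𝓘(ℝ, E) M))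
  map_lie : ∀ X Y : 𝔤,
    field ⁅X, Y⁆ = VectorField.mlieBracket 𝓘(ℝ, E) (field X) (field Y)

/-- `j : N → P` exhibits `N` as an (immersed) integral manifold of the distribution `D` on `P`:
it is an injective smooth immersion and the image of `T_n N` is `D (j n)` for every `n`. -/
structure IsIntegralManifold {V : Type*} [NormedAddCommGroup V] [NormedSpace ℝ V]
    {N : Type*} [TopologicalSpace N] [ChartedSpace V N]
    {E' H' : Type*} [NormedAddCommGroup E'] [NormedSpace ℝ E'] [TopologicalSpace H']
    (J : ModelWithCorners ℝ E' H') {P : Type*} [TopologicalSpace P] [ChartedSpace H' P]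
    (D : Π p : P, Set (TangentSpace J p)) (j : N → P) : Prop where
  injective : Function.Injective j
  smooth : ContMDiff 𝓘(ℝ, V) J ∞ j
  immersion : ∀ n : N, Function.Injective (mfderiv 𝓘(ℝ, V) J j n)
  tangent : ∀ n : N, Set.range (mfderiv 𝓘(ℝ, V) J j n) = D (j n)

/-- The leaf through `p` of an integrable distribution `D` on `P`, i.e. its maximal connected
integral manifold through `p`, as a subset of `P`: the union of all connected integral manifolds
of `D` which contain `p`. The vector space `V`, of the same dimension as `D`, is the model space
of the integral manifolds. (Every integral manifold of a Hausdorff `P` is Hausdorff, as it maps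
injectively and continuously to `P`.) -/
def leafThrough (V : Type*) [NormedAddCommGroup V] [NormedSpace ℝ V]
    {E' H' : Type*} [NormedAddCommGroup E'] [NormedSpace ℝ E'] [TopologicalSpace H']
    (J : ModelWithCorners ℝ E' H') {P : Type w} [TopologicalSpace P] [ChartedSpace H' P]
    (D : Π p : P, Set (TangentSpace J p)) (p : P) : Set P :=
  {q | ∃ (N : Type w) (_ : TopologicalSpace N) (_ : ChartedSpace V N)
    (_ : IsManifold 𝓘(ℝ, V) ∞ N) (_ : ConnectedSpace N) (j : N → P),
    IsIntegralManifold (V := V) J D j ∧ p ∈ Set.range j ∧ q ∈ Set.range j}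

namespace LieAlgebraAction

variable {𝔤 : Type*} [LieRing 𝔤] [LieAlgebra ℝ 𝔤]
  {E : Type*} [NormedAddCommGroup E] [NormedSpace ℝ E]
  {M : Type*} [TopologicalSpace M] [ChartedSpace E M] [IsManifold 𝓘(ℝ, E) ∞ M]
  {F : Type*} [NormedAddCommGroup F] [NormedSpace ℝ F] [CompleteSpace F]
  {G : Type*} [TopologicalSpace G] [ChartedSpace F G] [Group G] [LieGroup 𝓘(ℝ, F) ∞ G]

/-- The action is free: `X ↦ ζ_X(y)` is injective for every point `y`. -/
def IsFree (ζ : LieAlgebraAction 𝔤 E M) : Prop :=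
  ∀ y : M, Function.Injective (fun X : 𝔤 ↦ ζ.field X y)

/-- The action is transitive: `X ↦ ζ_X(y)` is onto `T_y M` for every point `y`. -/
def IsTransitive (ζ : LieAlgebraAction 𝔤 E M) : Prop :=
  ∀ y : M, Function.Surjective (fun X : 𝔤 ↦ ζ.field X y)

/-- The graph distribution `{(L_X(g), ζ_X(y)) : X ∈ 𝔤}` on `G × M`, where `L_X` is the left
invariant vector field generated by `X`. The isomorphism `e` identifies `𝔤` with the Lie algebra
of `G`. -/
def graphDistribution (ζ : LieAlgebraAction 𝔤 E M)
    (e : 𝔤 ≃ₗ⁅ℝ⁆ GroupLieAlgebra 𝓘(ℝ, F) G) (p : G × M) :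
    Set (TangentSpace (𝓘(ℝ, F).prod 𝓘(ℝ, E)) p) :=
  Set.range (fun X : 𝔤 ↦
    ((mulInvariantVectorField (e X) p.1, ζ.field X p.2) :
      TangentSpace 𝓘(ℝ, F) p.1 × TangentSpace 𝓘(ℝ, E) p.2))

/-- The subset `W_x = pr₁(L(x))` of `G`, where `L(x)` is the leaf of the graph distribution
through `(1, x)`. -/
def developingDomain (ζ : LieAlgebraAction 𝔤 E M)
    (e : 𝔤 ≃ₗ⁅ℝ⁆ GroupLieAlgebra 𝓘(ℝ, F) G) (x : M) : Set G :=
  Prod.fst '' leafThrough F (𝓘(ℝ, F).prod 𝓘(ℝ, E)) (ζ.graphDistribution e) (1, x)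

/-- A smooth map `C : M → G` is `𝔤`-equivariant if, for each `X`, the fundamental vector field
`ζ_X` on `M` and the left invariant vector field `L_X` on `G` are `C`-related. -/
structure IsEquivariant (ζ : LieAlgebraAction 𝔤 E M)
    (e : 𝔤 ≃ₗ⁅ℝ⁆ GroupLieAlgebra 𝓘(ℝ, F) G) (C : M → G) : Prop where
  smooth : ContMDiff 𝓘(ℝ, E) 𝓘(ℝ, F) ∞ C
  related : ∀ (X : 𝔤) (y : M),
    mfderiv 𝓘(ℝ, E) 𝓘(ℝ, F) C y (ζ.field X y) = mulInvariantVectorField (e X) (C y)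

/-- `ρ` is a smooth right action of `G` on `M` whose fundamental vector fields, given at `y` by
the derivative of `g ↦ y · g` at the identity, are the `ζ_X`. -/
structure IsIntegratedBy (ζ : LieAlgebraAction 𝔤 E M)
    (e : 𝔤 ≃ₗ⁅ℝ⁆ GroupLieAlgebra 𝓘(ℝ, F) G) (ρ : M → G → M) : Prop where
  smooth : ContMDiff (𝓘(ℝ, E).prod 𝓘(ℝ, F)) 𝓘(ℝ, E) ∞ (fun p : M × G ↦ ρ p.1 p.2)
  act_one : ∀ y : M, ρ y 1 = y
  act_mul : ∀ (y : M) (g h : G), ρ y (g * h) = ρ (ρ y g) h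
  fundamental : ∀ (X : 𝔤) (y : M),
    mfderiv 𝓘(ℝ, F) 𝓘(ℝ, E) (ρ y) 1 (e X) = ζ.field X (ρ y 1)

end LieAlgebraAction

/-! The action is free and transitive, so the fields `ζ_X` frame `TM`, and equivariance of `f : M →
G` says exactly that `f` has a prescribed left logarithmic derivative, namely the form sending `ζ_X`
to `e X`. Since `ζ` and `X ↦ L_X` have the same structure constants, this form satisfies the
Maurer–Cartan equation.

Local existence: in charts the condition on `f` is a total differential equation `Df(u) = Φ(u, f
u)`, and equality of the structure constants makes it integrable (`fderiv_comp_inverse_symm`). The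
Frobenius theorem `exists_eventually_hasFDerivAt_of_integrable` solves it by integrating along rays
and comparing neighbouring rays with Grönwall's inequality.

Uniqueness and gluing: two maps with the same logarithmic derivative differ by a locally constant
left factor (`HasLogDerivAt.mfderiv_mul_inv`). Local solutions therefore form a covering of `M` with
discrete fibre `G`; as `M` is simply connected, it has a section
(`exists_glue_of_ratio_eventually_const`), which is `C_x`.

Leaves: the leaf through `(e, x)` is the graph of `C_x`, again by uniqueness of logarithmic
derivatives along an integral manifold. Hence `W_x` is the image of `C_x`, open because `C_x` maps a
frame to a frame and is thus a local diffeomorphism.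

Integrated actions: the orbit map of `x` relates `L_X` to `ζ_X`, so it inverts `C_x` by uniqueness.
-/

section Development

open Set Metric Filter Topology
open scoped NNReal

/-! ### Tools from ordinary differential equations -/

/-- The Picard–Lindelöf theorem, with the information that the solution stays in the ball on which
the assumptions hold. -/
theorem IsPicardLindelof.exists_eq_forall_mem_closedBall_hasDerivWithinAt
    {F : Type*} [NormedAddCommGroup F] [NormedSpace ℝ F] [CompleteSpace F]
    {f : ℝ → F → F} {tmin tmax : ℝ} {t₀ : Icc tmin tmax} {x₀ x : F} {a r L K : ℝ≥0}
    (hf : IsPicardLindelof f t₀ x₀ a r L K) (hx : x ∈ closedBall x₀ r) :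
    ∃ α : ℝ → F, α t₀ = x ∧ ∀ t ∈ Icc tmin tmax, α t ∈ closedBall x₀ a ∧
      HasDerivWithinAt α (f t (α t)) (Icc tmin tmax) t := by
  obtain ⟨α, hα⟩ := ODE.FunSpace.exists_isFixedPt_next hf hx
  refine ⟨α.compProj, by rw [ODE.FunSpace.compProj_val, ← hα, ODE.FunSpace.next_apply₀],
    fun t ht ↦ ⟨α.compProj_mem_closedBall hf.mul_max_le, ?_⟩⟩
  apply ODE.hasDerivWithinAt_picard_Icc t₀.2 hf.continuousOn_uncurry
    α.continuous_compProj.continuousOn (fun _ ht' ↦ α.compProj_mem_closedBall hf.mul_max_le)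
    x ht |>.congr_of_mem _ ht
  intro t' ht'
  nth_rw 1 [← hα]
  rw [ODE.FunSpace.compProj_of_mem ht', ODE.FunSpace.next_apply]

/-- With equal initial values the Grönwall bound is linear in the defect, so a defect of order `‖h‖
^ 2` gives a distance of order `‖h‖ ^ 2`. -/
theorem gronwallBound_zero_left_eq_mul (K ε x : ℝ) :
    gronwallBound 0 K ε x = ε * gronwallBound 0 K 1 x := by
  by_cases hK : K = 0
  · simp [hK, gronwallBound_K0]
  · simp only [gronwallBound_of_K_ne_0 hK]; ring

/-! ### The Frobenius theorem for total differential equations -/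

section TotalDifferentialEquation

variable {E : Type*} [NormedAddCommGroup E] [NormedSpace ℝ E]
  {F : Type*} [NormedAddCommGroup F] [NormedSpace ℝ F]

/-- Mean value inequality on the segment, where the derivative stays within `K * ‖k‖` of its value
at `x`; the sharper constant `K / 2` is not needed. -/
theorem norm_taylor_two_le_of_lipschitzOnWith_fderiv {f : E → F} {s : Set E} {K : ℝ≥0}
    (hs : Convex ℝ s) (hd : ∀ x ∈ s, DifferentiableAt ℝ f x)
    (hl : LipschitzOnWith K (fderiv ℝ f) s) {x k : E} (hx : x ∈ s) (hk : x + k ∈ s) :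
    ‖f (x + k) - f x - fderiv ℝ f x k‖ ≤ K * ‖k‖ ^ 2 := by
  have hseg : segment ℝ x (x + k) ⊆ s := hs.segment_subset hx hk
  have := (convex_segment x (x + k)).norm_image_sub_le_of_norm_hasFDerivWithin_le'
    (f := f) (f' := fderiv ℝ f) (φ := fderiv ℝ f x) (C := K * ‖k‖)
    (fun z hz ↦ (hd z (hseg hz)).hasFDerivAt.hasFDerivWithinAt)
    (fun z hz ↦ by
      refine (hl.norm_sub_le (hseg hz) hx).trans ?_
      gcongr
      simpa using norm_sub_le_of_mem_segment hz)
    (left_mem_segment ℝ _ _) (right_mem_segment ℝ _ _)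
  simpa [pow_two, mul_assoc] using this

/-- Local bounds for a `C²` map. -/
theorem ContDiffAt.exists_closedBall_bounds {f : E → F} {x₀ : E} (hf : ContDiffAt ℝ 2 f x₀)
    {S : Set E} (hS : S ∈ 𝓝 x₀) :
    ∃ R > 0, ∃ K : ℝ≥0, closedBall x₀ R ⊆ S ∧ (∀ x ∈ closedBall x₀ R, DifferentiableAt ℝ f x) ∧
      (∀ x ∈ closedBall x₀ R, ‖f x‖ ≤ K) ∧ (∀ x ∈ closedBall x₀ R, ‖fderiv ℝ f x‖ ≤ K) ∧
      LipschitzOnWith K f (closedBall x₀ R) ∧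
      LipschitzOnWith K (fderiv ℝ f) (closedBall x₀ R) := by
  have hf' : ContDiffAt ℝ 1 (fderiv ℝ f) x₀ := hf.fderiv_right (m := 1) (by norm_num)
  obtain ⟨K₁, t₁, ht₁, hl₁⟩ := (hf.of_le (by norm_num) : ContDiffAt ℝ 1 f x₀).exists_lipschitzOnWith
  obtain ⟨K₂, t₂, ht₂, hl₂⟩ := hf'.exists_lipschitzOnWith
  have hd : ∀ᶠ x in 𝓝 x₀, DifferentiableAt ℝ f x := by
    filter_upwards [hf.eventually (by simp)] with x hx using hx.differentiableAt (by simp)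
  have h₁ : ∀ᶠ x in 𝓝 x₀, ‖f x‖ < ‖f x₀‖ + 1 :=
    hf.continuousAt.norm.eventually_lt_const (by simp)
  have h₂ : ∀ᶠ x in 𝓝 x₀, ‖fderiv ℝ f x‖ < ‖fderiv ℝ f x₀‖ + 1 :=
    hf'.continuousAt.norm.eventually_lt_const (by simp)
  obtain ⟨R, hR, hball⟩ := nhds_basis_closedBall.mem_iff.1
    (((hd.and h₁).and h₂).and ((show ∀ᶠ x in 𝓝 x₀, x ∈ t₁ from ht₁).and
      ((show ∀ᶠ x in 𝓝 x₀, x ∈ t₂ from ht₂).and (show ∀ᶠ x in 𝓝 x₀, x ∈ S from hS))))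
  let K : ℝ≥0 := max (max K₁ K₂) (max (‖f x₀‖₊ + 1) (‖fderiv ℝ f x₀‖₊ + 1))
  have hK₁ : K₁ ≤ K := (le_max_left _ _).trans (le_max_left _ _)
  have hK₂ : K₂ ≤ K := (le_max_right _ _).trans (le_max_left _ _)
  have hK₃ : ‖f x₀‖ + 1 ≤ K :=
    NNReal.coe_le_coe.2 ((le_max_left (‖f x₀‖₊ + 1) _).trans (le_max_right _ _))
  have hK₄ : ‖fderiv ℝ f x₀‖ + 1 ≤ K :=
    NNReal.coe_le_coe.2 ((le_max_right _ (‖fderiv ℝ f x₀‖₊ + 1)).trans (le_max_right _ _))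
  refine ⟨R, hR, K, fun x hx ↦ (hball hx).2.2.2, fun x hx ↦ (hball hx).1.1.1,
    fun x hx ↦ (hball hx).1.1.2.le.trans hK₃, fun x hx ↦ (hball hx).1.2.le.trans hK₄,
    (hl₁.mono fun x hx ↦ (hball hx).2.1).weaken hK₁,
    (hl₂.mono fun x hx ↦ (hball hx).2.2.1).weaken hK₂⟩

theorem mem_closedBall_prodMk {E F : Type*} [SeminormedAddCommGroup E]
    [SeminormedAddCommGroup F] {u₀ u : E} {y₀ y : F} {R : ℝ} (hu : ‖u - u₀‖ ≤ R)
    (hy : ‖y - y₀‖ ≤ R) : (u, y) ∈ closedBall (u₀, y₀) R := by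
  rw [mem_closedBall, Prod.dist_eq, dist_eq_norm, dist_eq_norm]
  exact max_le hu hy

/-- Restricting a total differential equation to rays gives solvable ordinary differential
equations. -/
theorem exists_ray_solution [CompleteSpace F] {Φ : E × F → E →L[ℝ] F} {u₀ : E} {y₀ : F} {R : ℝ}
    {K : ℝ≥0} (hR : 0 ≤ R)
    (hd : ContinuousOn Φ (closedBall (u₀, y₀) R)) (hb : ∀ p ∈ closedBall (u₀, y₀) R, ‖Φ p‖ ≤ K)
    (hl : LipschitzOnWith K Φ (closedBall (u₀, y₀) R)) {v : E} (hv : ‖v‖ ≤ R) (hv1 : ‖v‖ ≤ 1)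
    (hKv : K * ‖v‖ ≤ R / 2) :
    ∃ y : ℝ → F, y 0 = y₀ ∧ ∀ t ∈ Icc (0 : ℝ) 1, ‖y t - y₀‖ ≤ R / 2 ∧
      HasDerivWithinAt y (Φ (u₀ + t • v, y t) v) (Icc 0 1) t := by
  have hmem : ∀ t ∈ Icc (0 : ℝ) 1, ∀ y ∈ closedBall y₀ (R / 2),
      (u₀ + t • v, y) ∈ closedBall (u₀, y₀) R := by
    intro t ht y hy
    refine mem_closedBall_prodMk ?_ ((mem_closedBall_iff_norm.1 hy).trans (by linarith))
    rw [add_sub_cancel_left, norm_smul, Real.norm_of_nonneg ht.1]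
    exact (mul_le_of_le_one_left (norm_nonneg _) ht.2).trans hv
  -- Solutions are confined to half the radius, leaving room for the variation `t • Φ (u₀ + t • v, y
  -- t) h` added later.
  obtain ⟨a, ha⟩ : ∃ a : ℝ≥0, (a : ℝ) = R / 2 := ⟨⟨R / 2, by linarith⟩, rfl⟩
  have hP : IsPicardLindelof (fun t y ↦ Φ (u₀ + t • v, y) v) (⟨0, by simp⟩ : Icc (0 : ℝ) 1) y₀
      a 0 (K * ‖v‖₊) K := by
    rw [← ha] at hmem
    refine ⟨fun t ht ↦ ?_, fun y hy ↦ ?_, fun t ht y hy ↦ ?_, ?_⟩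
    · refine LipschitzOnWith.of_dist_le_mul fun y hy z hz ↦ ?_
      rw [dist_eq_norm, ← sub_apply]
      refine (ContinuousLinearMap.le_opNorm _ _).trans ?_
      have := hl.dist_le_mul _ (hmem t ht y hy) _ (hmem t ht z hz)
      rw [dist_eq_norm, Prod.dist_eq, dist_self, max_eq_right dist_nonneg] at this
      calc _ ≤ (K * dist y z) * 1 := by gcongr
        _ = _ := mul_one _
    · have h1 : ContinuousOn (fun t : ℝ ↦ Φ (u₀ + t • v, y)) (Icc 0 1) :=
        hd.comp (by fun_prop) fun t ht ↦ hmem t ht y hy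
      exact h1.clm_apply continuousOn_const
    · simp only [NNReal.coe_mul, coe_nnnorm]
      exact (ContinuousLinearMap.le_opNorm _ _).trans (by gcongr; exact hb _ (hmem t ht y hy))
    · simpa [ha] using hKv
  obtain ⟨y, hy0, hy⟩ := hP.exists_eq_forall_mem_closedBall_hasDerivWithinAt
    (mem_closedBall_self le_rfl)
  exact ⟨y, hy0, fun t ht ↦ ⟨ha ▸ mem_closedBall_iff_norm.1 (hy t ht).1, (hy t ht).2⟩⟩

/-- If `y` solves the total differential equation `Dy = Φ(u, y)` along the ray in direction `v`,
then `t ↦ y t + t • Φ (u₀ + t • v, y t) h` solves it up to second order along the ray in direction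
`v + h`, provided that `Φ` is integrable at the points considered. -/
theorem hasDerivWithinAt_variation {Φ : E × F → E →L[ℝ] F} {u₀ v h : E} {y : ℝ → F} {t : ℝ}
    {s : Set ℝ} (hΦ : DifferentiableAt ℝ Φ (u₀ + t • v, y t))
    (hint : ∀ a b, fderiv ℝ Φ (u₀ + t • v, y t) (a, Φ (u₀ + t • v, y t) a) b =
      fderiv ℝ Φ (u₀ + t • v, y t) (b, Φ (u₀ + t • v, y t) b) a)
    (hy : HasDerivWithinAt y (Φ (u₀ + t • v, y t) v) s t) :
    HasDerivWithinAt (fun t ↦ y t + t • Φ (u₀ + t • v, y t) h)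
      (Φ (u₀ + t • v, y t) (v + h) +
        fderiv ℝ Φ (u₀ + t • v, y t) (t • (h, Φ (u₀ + t • v, y t) h)) v) s t := by
  have h1 : HasDerivWithinAt (fun t : ℝ ↦ (u₀ + t • v, y t)) (v, Φ (u₀ + t • v, y t) v) s t := by
    refine HasDerivWithinAt.prodMk ?_ hy
    simpa using ((hasDerivAt_id t).smul_const v).const_add u₀ |>.hasDerivWithinAt
  have h2 : HasDerivWithinAt (fun t : ℝ ↦ Φ (u₀ + t • v, y t))
      (fderiv ℝ Φ (u₀ + t • v, y t) (v, Φ (u₀ + t • v, y t) v)) s t :=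
    hΦ.hasFDerivAt.comp_hasDerivWithinAt t h1
  have h3 := hy.fun_add
    ((hasDerivWithinAt_id t s).fun_smul (h2.clm_apply (hasDerivWithinAt_const t s h)))
  refine h3.congr_deriv ?_
  -- The product rule yields the derivative of `Φ` along the ray `v`, applied to `h`; integrability
  -- swaps `v` and `h`, which turns it into the first-order change of `Φ` towards the varied curve,
  -- applied to `v`.
  rw [map_zero, add_zero, one_smul, hint v h, map_smul, smul_apply, map_add]
  simp only [id_eq]
  abel

/-- The defect of the varied curve as a solution along `v + h` is second order in `h`: with
displacement `k = t • (h, Φ q h)`, it consists of the Taylor remainder of `Φ` at `q` and of the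
cross term `fderiv ℝ Φ q k h`. These give the two summands of the constant. -/
theorem norm_variation_sub_le {Φ : E × F → E →L[ℝ] F} {u₀ v h : E} {y : F} {t : ℝ} {K : ℝ≥0}
    {s : Set (E × F)} (hs : Convex ℝ s) (ht : t ∈ Icc (0 : ℝ) 1)
    (hd : ∀ p ∈ s, DifferentiableAt ℝ Φ p) (hb : ∀ p ∈ s, ‖Φ p‖ ≤ K)
    (hb' : ∀ p ∈ s, ‖fderiv ℝ Φ p‖ ≤ K) (hl : LipschitzOnWith K (fderiv ℝ Φ) s)
    (hvh : ‖v + h‖ ≤ 1) (hq : (u₀ + t • v, y) ∈ s)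
    (hqk : (u₀ + t • (v + h), y + t • Φ (u₀ + t • v, y) h) ∈ s) :
    ‖Φ (u₀ + t • v, y) (v + h) +
        fderiv ℝ Φ (u₀ + t • v, y) (t • (h, Φ (u₀ + t • v, y) h)) v -
      Φ (u₀ + t • (v + h), y + t • Φ (u₀ + t • v, y) h) (v + h)‖ ≤
      (K * (1 + K) ^ 2 + K * (1 + K)) * ‖h‖ ^ 2 := by
  set q := (u₀ + t • v, y) with hqdef
  set k := t • (h, Φ q h) with hk
  have hqk' : (u₀ + t • (v + h), y + t • Φ q h) = q + k := by
    simp [hqdef, hk, add_assoc]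
  rw [hqk'] at hqk ⊢
  have hkn : ‖k‖ ≤ (1 + K) * ‖h‖ := by
    rw [hk, norm_smul, Real.norm_of_nonneg ht.1]
    refine (mul_le_of_le_one_left (norm_nonneg _) ht.2).trans ?_
    rw [Prod.norm_def]
    have : ‖Φ q h‖ ≤ K * ‖h‖ := (Φ q).le_of_opNorm_le (hb q hq) h
    have h0 : 0 ≤ K * ‖h‖ := by positivity
    exact max_le (by nlinarith [norm_nonneg h]) (by nlinarith [norm_nonneg h])
  have htay := norm_taylor_two_le_of_lipschitzOnWith_fderiv hs hd hl hq hqk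
  have heq : Φ q (v + h) + fderiv ℝ Φ q k v - Φ (q + k) (v + h) =
      -((Φ (q + k) - Φ q - fderiv ℝ Φ q k) (v + h)) - fderiv ℝ Φ q k h := by
    simp only [sub_apply, map_add]
    abel
  rw [heq]
  have e1 : ‖(Φ (q + k) - Φ q - fderiv ℝ Φ q k) (v + h)‖ ≤ K * ((1 + K) * ‖h‖) ^ 2 := by
    refine (ContinuousLinearMap.le_opNorm _ _).trans ?_
    calc _ ≤ (K * ‖k‖ ^ 2) * 1 := by gcongr
      _ ≤ _ := by rw [mul_one]; gcongr
  have e2 : ‖fderiv ℝ Φ q k h‖ ≤ K * ((1 + K) * ‖h‖) * ‖h‖ := by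
    refine (ContinuousLinearMap.le_opNorm _ _).trans ?_
    gcongr
    exact (ContinuousLinearMap.le_of_opNorm_le _ (hb' q hq) _).trans (by gcongr)
  calc _ ≤ ‖(Φ (q + k) - Φ q - fderiv ℝ Φ q k) (v + h)‖ + ‖fderiv ℝ Φ q k h‖ :=
        (norm_sub_le _ _).trans_eq (by rw [norm_neg])
    _ ≤ _ := add_le_add e1 e2
    _ = _ := by ring

/-- The **Frobenius theorem** for total differential equations: if `Φ` is `C²` and integrable, the
equation `Df(u) = Φ(u, f u)` has a local solution with any prescribed initial value. -/
theorem exists_eventually_hasFDerivAt_of_integrable [CompleteSpace F] {Φ : E × F → E →L[ℝ] F}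
    {u₀ : E} {y₀ : F} (hΦ : ContDiffAt ℝ 2 Φ (u₀, y₀))
    (hint : ∀ᶠ p in 𝓝 (u₀, y₀), ∀ a b,
      fderiv ℝ Φ p (a, Φ p a) b = fderiv ℝ Φ p (b, Φ p b) a)
    {S : Set (E × F)} (hS : S ∈ 𝓝 (u₀, y₀)) :
    ∃ f : E → F, f u₀ = y₀ ∧
      ∀ᶠ u in 𝓝 u₀, (u, f u) ∈ S ∧ HasFDerivAt f (Φ (u, f u)) u := by
  obtain ⟨R, hR, K, hsub, hd, hb, hb', hl, hl'⟩ := hΦ.exists_closedBall_bounds (inter_mem hS hint)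
  have hcont : ContinuousOn Φ (closedBall (u₀, y₀) R) := hl.continuousOn
  -- The three bounds keep rays in the ball, make `K` a Lipschitz constant for every ray equation,
  -- and keep solutions within `R / 2` of `y₀`; the `+ 1` avoids division by zero.
  let r : ℝ := min (min R 1) (R / (2 * (K + 1)))
  have hr : 0 < r := by positivity
  have hrR : r ≤ R := (min_le_left _ _).trans (min_le_left _ _)
  have hr1 : r ≤ 1 := (min_le_left _ _).trans (min_le_right _ _)
  have hKr : ∀ v : E, ‖v‖ ≤ r → K * ‖v‖ ≤ R / 2 := by
    intro v hv
    calc (K : ℝ) * ‖v‖ ≤ (K + 1) * (R / (2 * (K + 1))) := by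
          gcongr
          · simp
          · exact hv.trans (min_le_right _ _)
      _ = R / 2 := by field_simp
  have hex : ∀ v : E, ∃ y : ℝ → F, ‖v‖ < r → y 0 = y₀ ∧ ∀ t ∈ Icc (0 : ℝ) 1,
      ‖y t - y₀‖ ≤ R / 2 ∧ HasDerivWithinAt y (Φ (u₀ + t • v, y t) v) (Icc 0 1) t := by
    intro v
    by_cases hv : ‖v‖ < r
    · obtain ⟨y, hy⟩ := exists_ray_solution hR.le hcont hb hl (hv.le.trans hrR) (hv.le.trans hr1)
        (hKr v hv.le)
      exact ⟨y, fun _ ↦ hy⟩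
    · exact ⟨0, fun h ↦ absurd h hv⟩
  choose Y hY using hex
  have htv : ∀ v : E, ‖v‖ < r → ∀ t ∈ Icc (0 : ℝ) 1, ‖u₀ + t • v - u₀‖ ≤ R := by
    intro v hv t ht
    rw [add_sub_cancel_left, norm_smul, Real.norm_of_nonneg ht.1]
    exact (mul_le_of_le_one_left (norm_nonneg _) ht.2).trans (hv.le.trans hrR)
  have hmem : ∀ v : E, ‖v‖ < r → ∀ t ∈ Icc (0 : ℝ) 1,
      (u₀ + t • v, Y v t) ∈ closedBall (u₀, y₀) R := fun v hv t ht ↦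
    mem_closedBall_prodMk (htv v hv t ht) ((((hY v hv).2 t ht).1).trans (by linarith))
  have hIci : ∀ {g : ℝ → F} {g' : F} {t : ℝ}, t ∈ Ico (0 : ℝ) 1 →
      HasDerivWithinAt g g' (Icc 0 1) t → HasDerivWithinAt g g' (Ici t) t := fun ht hg ↦
    hg.mono_of_mem_nhdsWithin (Icc_mem_nhdsGE_of_mem ht)
  set C : ℝ := K * (1 + K) ^ 2 + K * (1 + K) with hC
  -- At time `1` this is the first-order expansion of the endpoint map `v ↦ Y v 1`, with derivative
  -- `Φ (u₀ + v, Y v 1)` and a quadratic remainder.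
  have hmain : ∀ v h : E, ‖v‖ < r → ‖v + h‖ < r → ‖h‖ < r →
      ‖Y (v + h) 1 - (Y v 1 + Φ (u₀ + v, Y v 1) h)‖ ≤ C * gronwallBound 0 K 1 1 * ‖h‖ ^ 2 := by
    intro v h hv hvh hh
    have hz : ∀ t ∈ Icc (0 : ℝ) 1,
        ‖Y v t + t • Φ (u₀ + t • v, Y v t) h - y₀‖ ≤ R := by
      intro t ht
      rw [add_sub_right_comm]
      refine (norm_add_le _ _).trans ?_
      have h1 := ((hY v hv).2 t ht).1
      have h2 : ‖t • Φ (u₀ + t • v, Y v t) h‖ ≤ R / 2 := by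
        rw [norm_smul, Real.norm_of_nonneg ht.1]
        exact (mul_le_of_le_one_left (norm_nonneg _) ht.2).trans
          (((Φ _).le_of_opNorm_le (hb _ (hmem v hv t ht)) h).trans (hKr h hh.le))
      linarith
    have hz' : ∀ t ∈ Icc (0 : ℝ) 1, HasDerivWithinAt
        (fun t ↦ Y v t + t • Φ (u₀ + t • v, Y v t) h)
        (Φ (u₀ + t • v, Y v t) (v + h) +
          fderiv ℝ Φ (u₀ + t • v, Y v t) (t • (h, Φ (u₀ + t • v, Y v t) h)) v) (Icc 0 1) t :=
      fun t ht ↦ hasDerivWithinAt_variation (hd _ (hmem v hv t ht))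
        (hsub (hmem v hv t ht)).2 ((hY v hv).2 t ht).2
    -- The exact solution along `v + h` is compared with the varied solution along `v`. Both start
    -- at `y₀`, and only the second has a defect.
    have hG := dist_le_of_approx_trajectories_ODE_of_mem (a := 0) (b := 1) (δ := 0) (K := K)
      (v := fun t y ↦ Φ (u₀ + t • (v + h), y) (v + h)) (s := fun _ ↦ closedBall y₀ R)
      (f := Y (v + h)) (f' := fun t ↦ Φ (u₀ + t • (v + h), Y (v + h) t) (v + h)) (εf := 0)
      (g := fun t ↦ Y v t + t • Φ (u₀ + t • v, Y v t) h)
      (g' := fun t ↦ Φ (u₀ + t • v, Y v t) (v + h) +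
          fderiv ℝ Φ (u₀ + t • v, Y v t) (t • (h, Φ (u₀ + t • v, Y v t) h)) v)
      (εg := C * ‖h‖ ^ 2) ?_ ?_ ?_ ?_ ?_ ?_ ?_ ?_ ?_ ?_ 1 (by simp)
    · rw [zero_add, sub_zero, gronwallBound_zero_left_eq_mul, dist_eq_norm] at hG
      simp only [one_smul] at hG
      exact hG.trans (le_of_eq (by ring))
    · intro t ht
      refine LipschitzOnWith.of_dist_le_mul fun y hy z hz ↦ ?_
      have ht' := Ico_subset_Icc_self ht
      rw [dist_eq_norm, ← sub_apply]
      refine (ContinuousLinearMap.le_opNorm _ _).trans ?_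
      have := hl.dist_le_mul _
        (mem_closedBall_prodMk (htv _ hvh t ht') (mem_closedBall_iff_norm.1 hy)) _
        (mem_closedBall_prodMk (htv _ hvh t ht') (mem_closedBall_iff_norm.1 hz))
      rw [dist_eq_norm, Prod.dist_eq, dist_self, max_eq_right dist_nonneg] at this
      calc _ ≤ (K * dist y z) * 1 := by gcongr; exact hvh.le.trans hr1
        _ = _ := mul_one _
    · exact fun t ht ↦ ((hY _ hvh).2 t ht).2.continuousWithinAt
    · exact fun t ht ↦ hIci ht ((hY _ hvh).2 t (Ico_subset_Icc_self ht)).2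
    · simp
    · exact fun t ht ↦ mem_closedBall_iff_norm.2
        ((((hY _ hvh).2 t (Ico_subset_Icc_self ht)).1).trans (by linarith))
    · exact fun t ht ↦ (hz' t ht).continuousWithinAt
    · exact fun t ht ↦ hIci ht (hz' t (Ico_subset_Icc_self ht))
    · intro t ht
      have ht' := Ico_subset_Icc_self ht
      rw [dist_eq_norm]
      exact norm_variation_sub_le (convex_closedBall _ _) ht' hd hb hb' hl' (hvh.le.trans hr1)
        (hmem v hv t ht') (mem_closedBall_prodMk (htv _ hvh t ht') (hz t ht'))
    · exact fun t ht ↦ mem_closedBall_iff_norm.2 (hz t (Ico_subset_Icc_self ht))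
    · simp [(hY _ hvh).1, (hY _ hv).1]
  -- The solution at `u` is the endpoint of the ray from `u₀` to `u`.
  refine ⟨fun u ↦ Y (u - u₀) 1, ?_, ?_⟩
  · have h0 : ‖(0 : E)‖ < r := by simpa using hr
    have := constant_of_has_deriv_right_zero (f := Y 0) (a := 0) (b := 1)
      (fun t ht ↦ ((hY 0 h0).2 t ht).2.continuousWithinAt)
      (fun t ht ↦ by simpa using hIci ht ((hY 0 h0).2 t (Ico_subset_Icc_self ht)).2) 1 (by simp)
    simp [this, (hY 0 h0).1]
  · filter_upwards [ball_mem_nhds u₀ hr] with u hu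
    have hv : ‖u - u₀‖ < r := mem_ball_iff_norm.1 hu
    have hm : (u, Y (u - u₀) 1) ∈ closedBall (u₀, y₀) R := by
      simpa using hmem (u - u₀) hv 1 (by simp)
    refine ⟨(hsub hm).1, ?_⟩
    rw [hasFDerivAt_iff_isLittleO_nhds_zero]
    refine Asymptotics.IsBigO.trans_isLittleO (g := fun h : E ↦ ‖h‖ ^ 2) ?_ ?_
    · refine Asymptotics.IsBigO.of_bound (C * gronwallBound 0 K 1 1) ?_
      have c1 : ∀ᶠ h in 𝓝 (0 : E), ‖u - u₀ + h‖ < r :=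
        (by fun_prop : Continuous fun h : E ↦ ‖u - u₀ + h‖).continuousAt.eventually_lt_const
          (by simpa using hv)
      have c2 : ∀ᶠ h in 𝓝 (0 : E), ‖h‖ < r :=
        continuous_norm.continuousAt.eventually_lt_const (by simpa using hr)
      filter_upwards [c1, c2] with h h1 h2
      have := hmain (u - u₀) h hv h1 h2
      rw [add_sub_cancel, ← sub_sub, sub_add_eq_add_sub] at this
      simpa using this
    · simpa using Asymptotics.isLittleO_norm_pow_id (E' := E) (n := 2) (by norm_num)

end TotalDifferentialEquation

/-! ### Gluing over a simply connected space -/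

/-- On a simply connected space, a family of local functions with values in a group, whose ratios
are locally constant, can be glued: there is a global function which differs from each of them
by a locally constant left factor. -/
theorem exists_glue_of_ratio_eventually_const {M : Type*} [TopologicalSpace M]
    [SimplyConnectedSpace M] [LocallyPathConnectedSpace M] {Γ : Type*} [Group Γ]
    {U : M → Set M} (hU : ∀ i, IsOpen (U i)) (hmem : ∀ i, i ∈ U i) (f : M → M → Γ)
    (hf : ∀ i j, ∀ y ∈ U i ∩ U j, ∀ᶠ z in 𝓝 y, f i z * (f j z)⁻¹ = f i y * (f j y)⁻¹)
    (x : M) (c : Γ) :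
    ∃ C : M → Γ, C x = c ∧
      ∀ i, ∀ y ∈ U i, ∀ᶠ z in 𝓝 y, C z * (f i z)⁻¹ = C y * (f i y)⁻¹ := by
  let _ : TopologicalSpace Γ := ⊥
  have _ : DiscreteTopology Γ := ⟨rfl⟩
  -- The coordinate `h` over `y` in chart `i` stands for the value `h * f i y`, which the coordinate
  -- changes preserve. With the discrete topology on `Γ`, locally constant ratios are exactly what
  -- makes these changes continuous.
  let Z : FiberBundleCore M M Γ :=
    { baseSet := U
      isOpen_baseSet := hU
      indexAt := id
      mem_baseSet_at := hmem
      coordChange := fun i j y h ↦ h * (f i y * (f j y)⁻¹)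
      coordChange_self := fun i y _ h ↦ by simp
      continuousOn_coordChange := by
        rintro i j ⟨y, h⟩ ⟨hy, -⟩
        refine ContinuousAt.continuousWithinAt ?_
        have hev : ∀ᶠ p : M × Γ in 𝓝 (y, h),
            p.2 * (f i p.1 * (f j p.1)⁻¹) = h * (f i y * (f j y)⁻¹) := by
          rw [nhds_prod_eq, nhds_discrete Γ]
          filter_upwards [prod_mem_prod (hf i j y hy) (mem_pure.2 (mem_singleton h))]
          rintro ⟨z, k⟩ ⟨hz, hk⟩
          have hk' : k = h := hk
          have hz' : f i z * (f j z)⁻¹ = f i y * (f j y)⁻¹ := hz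
          simp only [hk', hz']
        exact continuousAt_const.congr (hev.mono fun _ h ↦ h.symm)
      coordChange_comp := fun i j k y _ h ↦ by group }
  have hcov : IsCoveringMap (Z.proj) := FiberBundle.isCoveringMap (F := Γ) (E := Z.Fiber)
  -- Lifting the identity of `M` gives a section; the chosen initial point stands for the value `c`
  -- at `x`.
  obtain ⟨s, ⟨hsx, hs⟩, -⟩ := hcov.existsUnique_continuousMap_lifts (ContinuousMap.id M) x
    (⟨x, (c * (f x x)⁻¹ : Γ)⟩ : Z.TotalSpace) rfl
  have hs' : ∀ y, (s y).1 = y := fun y ↦ congrFun hs y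
  let h : M → Γ := fun y ↦ (s y).2
  refine ⟨fun y ↦ h y * f y y, ?_, fun i y hy ↦ ?_⟩
  · have hx : h x = c * (f x x)⁻¹ := congrArg (fun e : Z.TotalSpace ↦ (e.2 : Γ)) hsx
    simp only [hx, inv_mul_cancel_right]
  · have hD : ∀ z, (Z.localTriv i (s z)).2 = h z * f z z * (f i z)⁻¹ := by
      intro z
      rw [Z.localTriv_apply]
      change h z * (f (s z).1 (s z).1 * (f i (s z).1)⁻¹) = _
      rw [hs' z, mul_assoc]
    -- A continuous coordinate with values in a discrete space is locally constant.
    have hcont : ContinuousAt (fun z ↦ (Z.localTriv i (s z)).2) y := by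
      refine continuousAt_snd.comp (ContinuousAt.comp (f := s) ?_ s.continuous.continuousAt)
      refine (Z.localTriv i).continuousAt ?_
      rw [Bundle.Trivialization.mem_source]
      change (s y).1 ∈ U i
      rwa [hs' y]
    have := hcont.eventually (eventually_of_mem (isOpen_discrete {(Z.localTriv i (s y)).2} |>.mem_nhds
      rfl) fun _ h ↦ h)
    filter_upwards [this] with z hz
    rw [← hD, ← hD]
    exact hz

/-! ### Uniqueness from logarithmic derivatives -/

section

variable {V : Type*} [NormedAddCommGroup V] [NormedSpace ℝ V]
  {N : Type*} [TopologicalSpace N] [ChartedSpace V N]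

/-- A map between manifolds whose derivative vanishes near a point is constant near this point. -/
theorem eventually_eq_of_mfderiv_eq_zero [IsManifold 𝓘(ℝ, V) 1 N]
    {F : Type*} [NormedAddCommGroup F] [NormedSpace ℝ F]
    {P : Type*} [TopologicalSpace P] [ChartedSpace F P] [IsManifold 𝓘(ℝ, F) 1 P]
    {h : N → P} {n : N}
    (hd : ∀ᶠ m in 𝓝 n, MDifferentiableAt 𝓘(ℝ, V) 𝓘(ℝ, F) h m ∧
      ∀ v, mfderiv 𝓘(ℝ, V) 𝓘(ℝ, F) h m v = 0) :
    ∀ᶠ m in 𝓝 n, h m = h n := by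
  set φ := extChartAt 𝓘(ℝ, V) n with hφ
  set ψ := extChartAt 𝓘(ℝ, F) (h n) with hψ
  have hcont : ContinuousAt h n := hd.self_of_nhds.1.continuousAt
  have hsrc : ∀ᶠ m in 𝓝 n, h m ∈ ψ.source :=
    hcont.eventually (extChartAt_source_mem_nhds (I := 𝓘(ℝ, F)) (h n))
  have hsymm : Tendsto φ.symm (𝓝 (φ n)) (𝓝 n) := by
    have := continuousAt_extChartAt_symm (I := 𝓘(ℝ, V)) n
    rwa [ContinuousAt, extChartAt_to_inv] at this
  have hopen : IsOpen φ.target := isOpen_extChartAt_target n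
  have htgt : ∀ᶠ u in 𝓝 (φ n), u ∈ φ.target := hopen.mem_nhds (mem_extChartAt_target n)
  have hder : ∀ᶠ u in 𝓝 (φ n), HasFDerivAt (ψ ∘ h ∘ φ.symm) (0 : V →L[ℝ] F) u := by
    filter_upwards [hsymm.eventually hd, hsymm.eventually hsrc, htgt] with u h1 h2 h3
    have d1 : MDifferentiableAt 𝓘(ℝ, V) 𝓘(ℝ, V) φ.symm u :=
      (mdifferentiableOn_extChartAt_symm u h3).mdifferentiableAt (hopen.mem_nhds h3)
    have d2 : MDifferentiableAt 𝓘(ℝ, F) 𝓘(ℝ, F) ψ (h (φ.symm u)) :=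
      mdifferentiableAt_extChartAt (by simpa [hψ] using h2)
    have d3 := h1.1.hasMFDerivAt
    have d4 : HasMFDerivAt 𝓘(ℝ, V) 𝓘(ℝ, F) (ψ ∘ h ∘ φ.symm) u
        ((mfderiv 𝓘(ℝ, F) 𝓘(ℝ, F) ψ (h (φ.symm u))).comp
          ((mfderiv 𝓘(ℝ, V) 𝓘(ℝ, F) h (φ.symm u)).comp
            (mfderiv 𝓘(ℝ, V) 𝓘(ℝ, V) φ.symm u))) :=
      d2.hasMFDerivAt.comp u (d3.comp u d1.hasMFDerivAt)
    refine (hasMFDerivAt_iff_hasFDerivAt.1 d4).congr_fderiv ?_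
    ext v
    have := h1.2 (mfderiv 𝓘(ℝ, V) 𝓘(ℝ, V) φ.symm u v)
    change mfderiv 𝓘(ℝ, F) 𝓘(ℝ, F) ψ (h (φ.symm u))
      (mfderiv 𝓘(ℝ, V) 𝓘(ℝ, F) h (φ.symm u) (mfderiv 𝓘(ℝ, V) 𝓘(ℝ, V) φ.symm u v)) = 0
    rw [this, map_zero]
  obtain ⟨r, hr, hball⟩ := Metric.eventually_nhds_iff_ball.1 hder
  have hconst : ∀ u ∈ ball (φ n) r, (ψ ∘ h ∘ φ.symm) u = (ψ ∘ h ∘ φ.symm) (φ n) := fun u hu ↦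
    isOpen_ball.is_const_of_fderiv_eq_zero (convex_ball _ _).isPreconnected
      (fun z hz ↦ (hball z hz).differentiableAt.differentiableWithinAt)
      (fun z hz ↦ (hball z hz).fderiv) hu (mem_ball_self hr)
  have hφc : Tendsto φ (𝓝 n) (𝓝 (φ n)) := continuousAt_extChartAt n
  filter_upwards [hφc.eventually (ball_mem_nhds _ hr), hsrc,
    extChartAt_source_mem_nhds (I := 𝓘(ℝ, V)) n] with m h1 h2 h3
  have h4 := hconst _ h1
  simp only [Function.comp_apply] at h4
  rw [φ.left_inv h3, φ.left_inv (mem_extChartAt_source n)] at h4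
  exact ψ.injOn h2 (mem_extChartAt_source _) h4

end

section LogDeriv

variable {V : Type*} [NormedAddCommGroup V] [NormedSpace ℝ V]
  {N : Type*} [TopologicalSpace N] [ChartedSpace V N]
  {F : Type*} [NormedAddCommGroup F] [NormedSpace ℝ F]
  {G : Type*} [TopologicalSpace G] [ChartedSpace F G] [Group G]

/-- `f` is differentiable at `n` with left logarithmic derivative `α`. -/
def HasLogDerivAt (f : N → G) {n : N}
    (α : TangentSpace 𝓘(ℝ, V) n → GroupLieAlgebra 𝓘(ℝ, F) G) : Prop :=
  MDifferentiableAt 𝓘(ℝ, V) 𝓘(ℝ, F) f n ∧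
    ∀ v, mfderiv 𝓘(ℝ, V) 𝓘(ℝ, F) f n v = mulInvariantVectorField (α v) (f n)

variable [LieGroup 𝓘(ℝ, F) ∞ G]

theorem mdifferentiable_mul_left_lieGroup (g : G) :
    MDifferentiable 𝓘(ℝ, F) 𝓘(ℝ, F) (fun h : G ↦ g * h) :=
  (contMDiff_mul_left (n := ∞)).mdifferentiable (by simp)

theorem mdifferentiable_mul_right_lieGroup (g : G) :
    MDifferentiable 𝓘(ℝ, F) 𝓘(ℝ, F) (fun h : G ↦ h * g) :=
  (contMDiff_mul_right (n := ∞)).mdifferentiable (by simp)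

/-- Left translations preserve left invariant vector fields. -/
theorem mfderiv_mul_left_mulInvariantVectorField (g h : G) (X : GroupLieAlgebra 𝓘(ℝ, F) G) :
    mfderiv 𝓘(ℝ, F) 𝓘(ℝ, F) (fun k : G ↦ g * k) h (mulInvariantVectorField X h) =
      mulInvariantVectorField X (g * h) := by
  have hfun : (fun k : G ↦ g * h * k) = (fun k ↦ g * k) ∘ (fun k ↦ h * k) := by
    ext k; simp [mul_assoc]
  have key := mfderiv_comp (I := 𝓘(ℝ, F)) (I' := 𝓘(ℝ, F)) (I'' := 𝓘(ℝ, F)) (1 : G)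
    (mdifferentiable_mul_left_lieGroup (F := F) g (h * 1))
    (mdifferentiable_mul_left_lieGroup (F := F) h 1)
  rw [← hfun] at key
  -- The base points `h` and `h * 1` are only propositionally equal; quantifying over `k` allows the
  -- derivative to be moved between them.
  have aux : ∀ k : G, k = h * 1 →
      (mfderiv 𝓘(ℝ, F) 𝓘(ℝ, F) (fun k : G ↦ g * k) k
        (mfderiv 𝓘(ℝ, F) 𝓘(ℝ, F) (fun k : G ↦ h * k) 1 X : F) : F) =
        mfderiv 𝓘(ℝ, F) 𝓘(ℝ, F) (fun k : G ↦ g * h * k) 1 X := by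
    rintro _ rfl
    exact (congrArg (fun A : TangentSpace 𝓘(ℝ, F) (1 : G) →L[ℝ] _ ↦ A X) key).symm
  exact aux h (mul_one h).symm

theorem mfderiv_mul_right_injective (g h : G) :
    Function.Injective (mfderiv 𝓘(ℝ, F) 𝓘(ℝ, F) (fun k : G ↦ k * h) g) := by
  have hfun : (fun k : G ↦ k * h⁻¹) ∘ (fun k : G ↦ k * h) = id := by ext k; simp
  have key := mfderiv_comp (I := 𝓘(ℝ, F)) (I' := 𝓘(ℝ, F)) (I'' := 𝓘(ℝ, F)) g
    (mdifferentiable_mul_right_lieGroup (F := F) h⁻¹ (g * h))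
    (mdifferentiable_mul_right_lieGroup (F := F) h g)
  rw [hfun, mfderiv_id] at key
  refine Function.LeftInverse.injective
    (g := mfderiv 𝓘(ℝ, F) 𝓘(ℝ, F) (fun k : G ↦ k * h⁻¹) (g * h)) fun v ↦ ?_
  exact (congrArg (fun A : TangentSpace 𝓘(ℝ, F) g →L[ℝ] _ ↦ A v) key).symm

/-- The ratio of two maps with the same logarithmic derivative has vanishing derivative. -/
theorem HasLogDerivAt.mfderiv_mul_inv {f₁ f₂ : N → G} {n : N}
    {α : TangentSpace 𝓘(ℝ, V) n → GroupLieAlgebra 𝓘(ℝ, F) G} (h₁ : HasLogDerivAt f₁ α)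
    (h₂ : HasLogDerivAt f₂ α) :
    MDifferentiableAt 𝓘(ℝ, V) 𝓘(ℝ, F) (fun m ↦ f₁ m * (f₂ m)⁻¹) n ∧
      ∀ v, mfderiv 𝓘(ℝ, V) 𝓘(ℝ, F) (fun m ↦ f₁ m * (f₂ m)⁻¹) n v = 0 := by
  have hmul : MDifferentiable (𝓘(ℝ, F).prod 𝓘(ℝ, F)) 𝓘(ℝ, F) (fun p : G × G ↦ p.1 * p.2) :=
    (contMDiff_mul 𝓘(ℝ, F) ∞).mdifferentiable (by simp)
  have hinv : MDifferentiable 𝓘(ℝ, F) 𝓘(ℝ, F) (fun g : G ↦ g⁻¹) :=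
    (contMDiff_inv 𝓘(ℝ, F) ∞).mdifferentiable (by simp)
  have hq : MDifferentiableAt 𝓘(ℝ, V) 𝓘(ℝ, F) (fun m ↦ f₁ m * (f₂ m)⁻¹) n :=
    (hmul (f₁ n, (f₂ n)⁻¹)).comp n (h₁.1.prodMk ((hinv (f₂ n)).comp n h₂.1))
  refine ⟨hq, fun v ↦ ?_⟩
  set q : N → G := fun m ↦ f₁ m * (f₂ m)⁻¹ with hqdef
  -- Differentiating `f₁ = q * f₂` instead of `q` avoids a formula for the derivative of inversion.
  -- By left invariance the term in `f₂` already equals the derivative of `f₁`, so the term in `q`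
  -- vanishes.
  have hf : f₁ = (fun p : G × G ↦ p.1 * p.2) ∘ fun m ↦ (q m, f₂ m) := by
    ext m; simp [hqdef]
  have key := mfderiv_comp n (hmul (q n, f₂ n)) (hq.prodMk h₂.1)
  rw [← hf, hq.mfderiv_prod h₂.1] at key
  have key' := congrArg (fun A : TangentSpace 𝓘(ℝ, V) n →L[ℝ] _ ↦ A v) key
  have h3 : mfderiv (𝓘(ℝ, F).prod 𝓘(ℝ, F)) 𝓘(ℝ, F) (fun p : G × G ↦ p.1 * p.2) (q n, f₂ n)
      (mfderiv 𝓘(ℝ, V) 𝓘(ℝ, F) q n v, mfderiv 𝓘(ℝ, V) 𝓘(ℝ, F) f₂ n v) =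
      mfderiv 𝓘(ℝ, F) 𝓘(ℝ, F) (fun k : G ↦ k * f₂ n) (q n) (mfderiv 𝓘(ℝ, V) 𝓘(ℝ, F) q n v) +
      mfderiv 𝓘(ℝ, F) 𝓘(ℝ, F) (fun k : G ↦ q n * k) (f₂ n)
        (mfderiv 𝓘(ℝ, V) 𝓘(ℝ, F) f₂ n v) := by
    exact mfderiv_prod_eq_add_apply (hmul _)
  have hqf : q n * f₂ n = f₁ n := by simp [hqdef]
  have h4 : mfderiv 𝓘(ℝ, V) 𝓘(ℝ, F) f₁ n v =
      mfderiv 𝓘(ℝ, F) 𝓘(ℝ, F) (fun k : G ↦ k * f₂ n) (q n) (mfderiv 𝓘(ℝ, V) 𝓘(ℝ, F) q n v) +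
      mfderiv 𝓘(ℝ, F) 𝓘(ℝ, F) (fun k : G ↦ q n * k) (f₂ n)
        (mfderiv 𝓘(ℝ, V) 𝓘(ℝ, F) f₂ n v) := key'.trans h3
  rw [h₂.2 v, mfderiv_mul_left_mulInvariantVectorField, h₁.2 v] at h4
  have h5 : (mulInvariantVectorField (α v) (q n * f₂ n) : F) =
      mulInvariantVectorField (α v) (f₁ n) := by rw [hqf]
  have h6 : (mfderiv 𝓘(ℝ, F) 𝓘(ℝ, F) (fun k : G ↦ k * f₂ n) (q n)
      (mfderiv 𝓘(ℝ, V) 𝓘(ℝ, F) q n v) : F) = 0 := by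
    have h7 : ∀ a b c : F, a = b + c → c = a → b = 0 := fun a b c h h' ↦ by
      rw [h'] at h; exact right_eq_add.1 h
    exact h7 _ _ _ h4 h5
  exact mfderiv_mul_right_injective (q n) (f₂ n) (h6.trans (map_zero _).symm)

theorem eventually_mul_inv_eq_of_hasLogDerivAt [IsManifold 𝓘(ℝ, V) 1 N] {f₁ f₂ : N → G} {n : N}
    {α : Π m : N, TangentSpace 𝓘(ℝ, V) m → GroupLieAlgebra 𝓘(ℝ, F) G}
    (h₁ : ∀ᶠ m in 𝓝 n, HasLogDerivAt f₁ (α m)) (h₂ : ∀ᶠ m in 𝓝 n, HasLogDerivAt f₂ (α m)) :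
    ∀ᶠ m in 𝓝 n, f₁ m * (f₂ m)⁻¹ = f₁ n * (f₂ n)⁻¹ := by
  have : IsManifold 𝓘(ℝ, F) 1 G := IsManifold.of_le (n := ∞) (by simp)
  refine eventually_eq_of_mfderiv_eq_zero (V := V) (F := F) (h := fun m ↦ f₁ m * (f₂ m)⁻¹) ?_
  filter_upwards [h₁, h₂] with m a b using a.mfderiv_mul_inv b

/-- A map on a connected manifold is determined by its logarithmic derivative and its value at a
point. -/
theorem eq_of_hasLogDerivAt [IsManifold 𝓘(ℝ, V) 1 N] [PreconnectedSpace N] {f₁ f₂ : N → G}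
    {α : Π m : N, TangentSpace 𝓘(ℝ, V) m → GroupLieAlgebra 𝓘(ℝ, F) G}
    (h₁ : ∀ m, HasLogDerivAt f₁ (α m)) (h₂ : ∀ m, HasLogDerivAt f₂ (α m)) {n : N}
    (h : f₁ n = f₂ n) : f₁ = f₂ := by
  have hloc : IsLocallyConstant fun m ↦ f₁ m * (f₂ m)⁻¹ :=
    (IsLocallyConstant.iff_eventually_eq _).2 fun m ↦
      eventually_mul_inv_eq_of_hasLogDerivAt (.of_forall h₁) (.of_forall h₂)
  ext m
  have := hloc.apply_eq_of_preconnectedSpace m n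
  simpa [h, mul_inv_eq_one] using this

end LogDeriv

/-! ### From frames with equal structure constants to an integrable equation -/

section

variable {E : Type*} [NormedAddCommGroup E] [NormedSpace ℝ E]
  {F : Type*} [NormedAddCommGroup F] [NormedSpace ℝ F]
  {V : Type*} [NormedAddCommGroup V] [NormedSpace ℝ V]

/-- Solutions of smooth total differential equations are smooth. -/
theorem contDiffOn_of_hasFDerivAt_graph {Φ : E × F → E →L[ℝ] F} {f : E → F} {s : Set E}
    (hs : IsOpen s) (hf : ∀ u ∈ s, HasFDerivAt f (Φ (u, f u)) u)
    (hΦ : ∀ u ∈ s, ContDiffAt ℝ ∞ Φ (u, f u)) : ContDiffOn ℝ ∞ f s := by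
  refine contDiffOn_infty.2 fun n ↦ ?_
  induction n with
  | zero =>
    exact contDiffOn_zero.2 fun u hu ↦ (hf u hu).continuousAt.continuousWithinAt
  | succ n ih =>
    push_cast
    refine (contDiffOn_succ_iff_fderiv_of_isOpen hs).2
      ⟨fun u hu ↦ (hf u hu).differentiableAt.differentiableWithinAt, fun h ↦ absurd h WithTop.coe_ne_top, ?_⟩
    -- Bootstrap: if `f` is `C^n`, so is its derivative `u ↦ Φ (u, f u)`.
    refine ContDiffOn.congr (f := fun u ↦ Φ (u, f u)) (fun u hu ↦ ?_) fun u hu ↦ (hf u hu).fderiv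
    exact ((hΦ u hu).of_le (by exact_mod_cast le_top)).comp_contDiffWithinAt
      (f := fun u ↦ (u, f u)) u (contDiffWithinAt_id.prodMk (ih u hu))

theorem fderiv_apply_const {T : E → V →L[ℝ] F} {u : E} (hT : DifferentiableAt ℝ T u) (X : V)
    (w : E) : fderiv ℝ (fun u ↦ T u X) u w = fderiv ℝ T u w X := by
  rw [fderiv_clm_apply hT (differentiableAt_const X)]
  simp

/-- Two families of vector fields with the same structure constants, the first of which is a frame,
define an integrable total differential equation. -/
theorem fderiv_comp_inverse_symm {Z : E → V →L[ℝ] E} {A : F → V →L[ℝ] F} {c : V → V → V}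
    {p : E × F} (hZ : DifferentiableAt ℝ Z p.1) (hA : DifferentiableAt ℝ A p.2)
    (hinv : ∀ᶠ u in 𝓝 p.1, (Z u).IsInvertible)
    (hd : DifferentiableAt ℝ (fun q : E × F ↦ (A q.2).comp (Z q.1).inverse) p)
    (hbZ : ∀ X Y, VectorField.lieBracket ℝ (fun u ↦ Z u X) (fun u ↦ Z u Y) p.1 = Z p.1 (c X Y))
    (hbA : ∀ X Y, VectorField.lieBracket ℝ (fun u ↦ A u X) (fun u ↦ A u Y) p.2 = A p.2 (c X Y))
    (a b : E) :
    fderiv ℝ (fun q : E × F ↦ (A q.2).comp (Z q.1).inverse) p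
        (a, (A p.2).comp (Z p.1).inverse a) b =
      fderiv ℝ (fun q : E × F ↦ (A q.2).comp (Z q.1).inverse) p
        (b, (A p.2).comp (Z p.1).inverse b) a := by
  set Φ : E × F → E →L[ℝ] F := fun q ↦ (A q.2).comp (Z q.1).inverse with hΦ
  have hΦZ : ∀ᶠ q in 𝓝 p, ∀ X, Φ q (Z q.1 X) = A q.2 X := by
    filter_upwards [continuousAt_fst.eventually hinv] with q hq X
    simp [hΦ, hq.inverse_apply_eq.2 rfl]
  -- This is the derivative of the identity `Φ q (Z q.1 X) = A q.2 X` at `p` in direction `w`.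
  -- Antisymmetrized over two frame vectors, it turns the desired symmetry into equality of the two
  -- brackets.
  have key : ∀ X w, fderiv ℝ Φ p w (Z p.1 X) + Φ p (fderiv ℝ Z p.1 w.1 X) =
      fderiv ℝ A p.2 w.2 X := by
    intro X w
    have h1 : HasFDerivAt (fun q : E × F ↦ Z q.1 X)
        ((ContinuousLinearMap.apply ℝ E X).comp
          ((fderiv ℝ Z p.1).comp (ContinuousLinearMap.fst ℝ E F))) p :=
      (ContinuousLinearMap.apply ℝ E X).hasFDerivAt.comp p
        (hZ.hasFDerivAt.comp p hasFDerivAt_fst)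
    have h2 : HasFDerivAt (fun q : E × F ↦ A q.2 X)
        ((ContinuousLinearMap.apply ℝ F X).comp
          ((fderiv ℝ A p.2).comp (ContinuousLinearMap.snd ℝ E F))) p :=
      (ContinuousLinearMap.apply ℝ F X).hasFDerivAt.comp p
        (hA.hasFDerivAt.comp p hasFDerivAt_snd)
    have h3 := (hd.hasFDerivAt.clm_apply h1).congr_of_eventuallyEq
      (hΦZ.mono fun q hq ↦ (hq X).symm)
    have h4 := congrArg (fun T : E × F →L[ℝ] F ↦ T w) (h3.unique h2)
    simpa [add_comm] using h4
  obtain ⟨X, rfl⟩ := hinv.self_of_nhds.surjective a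
  obtain ⟨Y, rfl⟩ := hinv.self_of_nhds.surjective b
  have hX := hΦZ.self_of_nhds X
  have hY := hΦZ.self_of_nhds Y
  have kX := key X (Z p.1 Y, A p.2 Y)
  have kY := key Y (Z p.1 X, A p.2 X)
  have bZ := hbZ X Y
  have bA := hbA X Y
  rw [VectorField.lieBracket, fderiv_apply_const hZ, fderiv_apply_const hZ] at bZ
  rw [VectorField.lieBracket, fderiv_apply_const hA, fderiv_apply_const hA, ← hΦZ.self_of_nhds (c X Y), ← bZ, map_sub] at bA
  change fderiv ℝ Φ p (Z p.1 X, Φ p (Z p.1 X)) (Z p.1 Y) =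
    fderiv ℝ Φ p (Z p.1 Y, Φ p (Z p.1 Y)) (Z p.1 X)
  rw [hX, hY, eq_sub_of_add_eq kX, eq_sub_of_add_eq kY]
  simp only at bA ⊢
  rw [sub_eq_sub_iff_sub_eq_sub, bA]

/-- Two families of vector fields with the same structure constants, the first of which is a frame,
are locally related by a smooth map. -/
theorem exists_contDiffOn_related [CompleteSpace F] [CompleteSpace V]
    {Z : E → V →L[ℝ] E} {A : F → V →L[ℝ] F} {c : V → V → V}
    {s : Set E} {t : Set F} (hs : IsOpen s) (ht : IsOpen t) (hZ : ContDiffOn ℝ ∞ Z s)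
    (hA : ContDiffOn ℝ ∞ A t) (hinv : ∀ u ∈ s, (Z u).IsInvertible)
    (hbZ : ∀ u ∈ s, ∀ X Y,
      VectorField.lieBracket ℝ (fun u ↦ Z u X) (fun u ↦ Z u Y) u = Z u (c X Y))
    (hbA : ∀ u ∈ t, ∀ X Y,
      VectorField.lieBracket ℝ (fun u ↦ A u X) (fun u ↦ A u Y) u = A u (c X Y))
    {u₀ : E} {y₀ : F} (hu₀ : u₀ ∈ s) (hy₀ : y₀ ∈ t) :
    ∃ (f : E → F) (U : Set E), IsOpen U ∧ u₀ ∈ U ∧ U ⊆ s ∧ MapsTo f U t ∧ f u₀ = y₀ ∧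
      ContDiffOn ℝ ∞ f U ∧ ∀ u ∈ U, ∀ X, fderiv ℝ f u (Z u X) = A (f u) X := by
  set Φ : E × F → E →L[ℝ] F := fun q ↦ (A q.2).comp (Z q.1).inverse with hΦ
  have hΦd : ∀ p ∈ s ×ˢ t, ContDiffAt ℝ ∞ Φ p := by
    rintro ⟨u, y⟩ ⟨hu, hy⟩
    have h1 : ContDiffAt ℝ ∞ (fun q : E × F ↦ A q.2) (u, y) :=
      (hA.contDiffAt (ht.mem_nhds hy)).comp (u, y) contDiffAt_snd
    have h2 : ContDiffAt ℝ ∞ (fun q : E × F ↦ Z q.1) (u, y) :=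
      (hZ.contDiffAt (hs.mem_nhds hu)).comp (u, y) contDiffAt_fst
    have h3 : ContDiffAt ℝ ∞ (fun q : E × F ↦ (Z q.1).inverse) (u, y) :=
      ContDiffAt.comp (g := ContinuousLinearMap.inverse) (f := fun q : E × F ↦ Z q.1) (u, y)
        (hinv u hu).contDiffAt_map_inverse h2
    exact h1.clm_comp h3
  have hst : s ×ˢ t ∈ 𝓝 (u₀, y₀) := (hs.prod ht).mem_nhds ⟨hu₀, hy₀⟩
  obtain ⟨f, hf0, hf⟩ := exists_eventually_hasFDerivAt_of_integrable
    ((hΦd _ ⟨hu₀, hy₀⟩).of_le ENat.LEInfty.out)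
    (by
      filter_upwards [hst] with p hp a b
      exact fderiv_comp_inverse_symm
        ((hZ.contDiffAt (hs.mem_nhds hp.1)).differentiableAt (by simp))
        ((hA.contDiffAt (ht.mem_nhds hp.2)).differentiableAt (by simp))
        (eventually_of_mem (hs.mem_nhds hp.1) hinv) ((hΦd p hp).differentiableAt (by simp))
        (hbZ _ hp.1) (hbA _ hp.2) a b) hst
  obtain ⟨U, hU, hUo, hu₀U⟩ := _root_.eventually_nhds_iff.1 hf
  refine ⟨f, U, hUo, hu₀U, fun u hu ↦ (hU u hu).1.1, fun u hu ↦ (hU u hu).1.2, hf0,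
    contDiffOn_of_hasFDerivAt_graph hUo (fun u hu ↦ (hU u hu).2) fun u hu ↦ hΦd _ (hU u hu).1,
    fun u hu X ↦ ?_⟩
  rw [(hU u hu).2.fderiv]
  simp [hΦ, (hinv u (hU u hu).1.1).inverse_apply_eq.2 rfl]

end

/-! ### Reading frames on manifolds in charts -/

section ChartFrame

variable {V : Type*} [NormedAddCommGroup V] [NormedSpace ℝ V] [FiniteDimensional ℝ V]
  {F : Type*} [NormedAddCommGroup F] [NormedSpace ℝ F]
  {P : Type*} [TopologicalSpace P] [ChartedSpace F P]

/-- A linear family of vector fields on a manifold, read in the preferred chart at `p₀`. -/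
noncomputable def chartFrame (W : V →ₗ[ℝ] (Π p : P, TangentSpace 𝓘(ℝ, F) p)) (p₀ : P) (u : F) :
    V →L[ℝ] F :=
  LinearMap.toContinuousLinearMap
    { toFun := fun X ↦
        VectorField.mpullback 𝓘(ℝ, F) 𝓘(ℝ, F) (extChartAt 𝓘(ℝ, F) p₀).symm (W X) u
      map_add' := fun X Y ↦ by
        rw [map_add, VectorField.mpullback_add_apply]; rfl
      map_smul' := fun a X ↦ by
        rw [map_smul, VectorField.mpullback_const_smul_apply]; rfl }

variable {W : V →ₗ[ℝ] (Π p : P, TangentSpace 𝓘(ℝ, F) p)} {p₀ : P}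

theorem isInvertible_mfderiv_extChartAt_symm_of_mem_target [IsManifold 𝓘(ℝ, F) 1 P] {u : F}
    (hu : u ∈ (extChartAt 𝓘(ℝ, F) p₀).target) :
    (mfderiv 𝓘(ℝ, F) 𝓘(ℝ, F) (extChartAt 𝓘(ℝ, F) p₀).symm u).IsInvertible := by
  have := isInvertible_mfderivWithin_extChartAt_symm (I := 𝓘(ℝ, F)) hu
  rwa [modelWithCornersSelf_coe, range_id, mfderivWithin_univ] at this

theorem contMDiffAt_extChartAt_symm_of_mem_target [IsManifold 𝓘(ℝ, F) ∞ P] {u : F}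
    (hu : u ∈ (extChartAt 𝓘(ℝ, F) p₀).target) :
    ContMDiffAt 𝓘(ℝ, F) 𝓘(ℝ, F) ∞ (extChartAt 𝓘(ℝ, F) p₀).symm u :=
  (contMDiffOn_extChartAt_symm p₀).contMDiffAt ((isOpen_extChartAt_target p₀).mem_nhds hu)

theorem mfderiv_symm_chartFrame [IsManifold 𝓘(ℝ, F) 1 P] {u : F}
    (hu : u ∈ (extChartAt 𝓘(ℝ, F) p₀).target) (X : V) :
    mfderiv 𝓘(ℝ, F) 𝓘(ℝ, F) (extChartAt 𝓘(ℝ, F) p₀).symm u (chartFrame W p₀ u X) =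
      W X ((extChartAt 𝓘(ℝ, F) p₀).symm u) :=
  (isInvertible_mfderiv_extChartAt_symm_of_mem_target hu).self_apply_inverse _

theorem mfderiv_extChartAt_eq_chartFrame [IsManifold 𝓘(ℝ, F) 1 P] {p : P}
    (hp : p ∈ (extChartAt 𝓘(ℝ, F) p₀).source) (X : V) :
    mfderiv 𝓘(ℝ, F) 𝓘(ℝ, F) (extChartAt 𝓘(ℝ, F) p₀) p (W X p) =
      chartFrame W p₀ (extChartAt 𝓘(ℝ, F) p₀ p) X := by
  have hu := (extChartAt 𝓘(ℝ, F) p₀).map_source hp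
  have aux : ∀ q, q = p →
      (mfderiv 𝓘(ℝ, F) 𝓘(ℝ, F) (extChartAt 𝓘(ℝ, F) p₀) q (W X q) : F) =
        mfderiv 𝓘(ℝ, F) 𝓘(ℝ, F) (extChartAt 𝓘(ℝ, F) p₀) p (W X p) := by
    rintro _ rfl; rfl
  have h := mfderiv_extChartAt_comp_mfderivWithin_extChartAt_symm (I := 𝓘(ℝ, F)) hu
  rw [modelWithCornersSelf_coe, range_id, mfderivWithin_univ] at h
  have h2 := congrArg (fun T : F →L[ℝ] F ↦ T (chartFrame W p₀ (extChartAt 𝓘(ℝ, F) p₀ p) X)) h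
  have h3 := mfderiv_symm_chartFrame (W := W) hu X
  refine (aux _ ((extChartAt 𝓘(ℝ, F) p₀).left_inv hp)).symm.trans ?_
  refine Eq.trans ?_ h2
  exact (congrArg (mfderiv 𝓘(ℝ, F) 𝓘(ℝ, F) (extChartAt 𝓘(ℝ, F) p₀) _) h3).symm

theorem contDiffOn_chartFrame [CompleteSpace F] [IsManifold 𝓘(ℝ, F) ∞ P]
    (hW : ∀ X, ContMDiff 𝓘(ℝ, F) 𝓘(ℝ, F).tangent ∞
      (fun p : P ↦ (⟨p, W X p⟩ : TangentBundle 𝓘(ℝ, F) P))) :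
    ContDiffOn ℝ ∞ (chartFrame W p₀) (extChartAt 𝓘(ℝ, F) p₀).target := by
  have : IsManifold 𝓘(ℝ, F) 1 P := IsManifold.of_le (n := ∞) (by simp)
  refine contDiffOn_clm_apply.2 fun X u hu ↦ ContDiffAt.contDiffWithinAt ?_
  exact contMDiffAt_vectorSpace_iff_contDiffAt.1
    (ContMDiffAt.mpullback_vectorField_preimage (n := ∞) (hW X _)
      (contMDiffAt_extChartAt_symm_of_mem_target hu)
      (isInvertible_mfderiv_extChartAt_symm_of_mem_target hu) le_rfl)

/-- Pullback along the inverse chart commutes with brackets, so the structure constants survive in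
coordinates. -/
theorem lieBracket_chartFrame [CompleteSpace F] [IsManifold 𝓘(ℝ, F) ∞ P]
    (hW : ∀ X, ContMDiff 𝓘(ℝ, F) 𝓘(ℝ, F).tangent ∞
      (fun p : P ↦ (⟨p, W X p⟩ : TangentBundle 𝓘(ℝ, F) P)))
    {c : V → V → V} (hc : ∀ X Y, VectorField.mlieBracket 𝓘(ℝ, F) (W X) (W Y) = W (c X Y))
    {u : F} (hu : u ∈ (extChartAt 𝓘(ℝ, F) p₀).target) (X Y : V) :
    VectorField.lieBracket ℝ (fun u ↦ chartFrame W p₀ u X) (fun u ↦ chartFrame W p₀ u Y) u =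
      chartFrame W p₀ u (c X Y) := by
  have : IsManifold 𝓘(ℝ, F) (minSmoothness ℝ 2) P := IsManifold.of_le (n := ∞) (by
    rw [minSmoothness_of_isRCLikeNormedField]; exact ENat.LEInfty.out)
  have h := VectorField.mpullback_mlieBracket (n := ∞) (V := W X) (W := W Y)
    (I := 𝓘(ℝ, F)) (I' := 𝓘(ℝ, F)) (f := (extChartAt 𝓘(ℝ, F) p₀).symm) (x₀ := u)
    ((hW X _).mdifferentiableAt (by simp)) ((hW Y _).mdifferentiableAt (by simp))
    (contMDiffAt_extChartAt_symm_of_mem_target hu) (by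
      rw [minSmoothness_of_isRCLikeNormedField]; exact ENat.LEInfty.out)
  rw [hc, ← VectorField.mlieBracketWithin_univ, VectorField.mlieBracketWithin_eq_lieBracketWithin] at h
  exact (h.trans (congrFun VectorField.lieBracketWithin_univ u)).symm

theorem isInvertible_chartFrame [CompleteSpace F] [IsManifold 𝓘(ℝ, F) 1 P]
    (hW : ∀ p, Function.Bijective fun X ↦ W X p) {u : F}
    (hu : u ∈ (extChartAt 𝓘(ℝ, F) p₀).target) : (chartFrame W p₀ u).IsInvertible := by
  have hb : Function.Bijective (chartFrame W p₀ u) :=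
    (isInvertible_mfderiv_extChartAt_symm_of_mem_target hu).inverse.bijective.comp (hW _)
  exact ⟨ContinuousLinearEquiv.ofBijective (chartFrame W p₀ u)
    (LinearMap.ker_eq_bot.2 hb.1) (LinearMap.range_eq_top.2 hb.2), rfl⟩

end ChartFrame

/-- Two linear families of vector fields on manifolds with the same structure constants, the first
of which is a frame, are locally related by a smooth map with a prescribed value at a point. -/
theorem exists_contMDiffOn_related
    {V : Type*} [NormedAddCommGroup V] [NormedSpace ℝ V] [FiniteDimensional ℝ V]
    {E : Type*} [NormedAddCommGroup E] [NormedSpace ℝ E] [CompleteSpace E]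
    {M : Type*} [TopologicalSpace M] [ChartedSpace E M] [IsManifold 𝓘(ℝ, E) ∞ M]
    {F : Type*} [NormedAddCommGroup F] [NormedSpace ℝ F] [CompleteSpace F]
    {P : Type*} [TopologicalSpace P] [ChartedSpace F P] [IsManifold 𝓘(ℝ, F) ∞ P]
    {Z : V →ₗ[ℝ] (Π y : M, TangentSpace 𝓘(ℝ, E) y)}
    {A : V →ₗ[ℝ] (Π p : P, TangentSpace 𝓘(ℝ, F) p)} {c : V → V → V}
    (hZ : ∀ X, ContMDiff 𝓘(ℝ, E) 𝓘(ℝ, E).tangent ∞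
      (fun y : M ↦ (⟨y, Z X y⟩ : TangentBundle 𝓘(ℝ, E) M)))
    (hA : ∀ X, ContMDiff 𝓘(ℝ, F) 𝓘(ℝ, F).tangent ∞
      (fun p : P ↦ (⟨p, A X p⟩ : TangentBundle 𝓘(ℝ, F) P)))
    (hcZ : ∀ X Y, VectorField.mlieBracket 𝓘(ℝ, E) (Z X) (Z Y) = Z (c X Y))
    (hcA : ∀ X Y, VectorField.mlieBracket 𝓘(ℝ, F) (A X) (A Y) = A (c X Y))
    (hb : ∀ y, Function.Bijective fun X ↦ Z X y) (y₀ : M) (p₀ : P) :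
    ∃ (f : M → P) (U : Set M), IsOpen U ∧ y₀ ∈ U ∧ f y₀ = p₀ ∧
      ContMDiffOn 𝓘(ℝ, E) 𝓘(ℝ, F) ∞ f U ∧
      ∀ y ∈ U, ∀ X, mfderiv 𝓘(ℝ, E) 𝓘(ℝ, F) f y (Z X y) = A X (f y) := by
  have : IsManifold 𝓘(ℝ, E) 1 M := IsManifold.of_le (n := ∞) (by simp)
  have : IsManifold 𝓘(ℝ, F) 1 P := IsManifold.of_le (n := ∞) (by simp)
  have : CompleteSpace V := FiniteDimensional.complete ℝ V
  set φ := extChartAt 𝓘(ℝ, E) y₀ with hφ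
  set ψ := extChartAt 𝓘(ℝ, F) p₀ with hψ
  obtain ⟨f, U, hU, hyU, hUs, hft, hf0, hfs, hfr⟩ := exists_contDiffOn_related
    (Z := chartFrame Z y₀) (A := chartFrame A p₀) (c := c)
    (isOpen_extChartAt_target y₀) (isOpen_extChartAt_target p₀)
    (contDiffOn_chartFrame hZ) (contDiffOn_chartFrame hA)
    (fun u hu ↦ isInvertible_chartFrame hb hu)
    (fun u hu X Y ↦ lieBracket_chartFrame hZ hcZ hu X Y)
    (fun u hu X Y ↦ lieBracket_chartFrame hA hcA hu X Y)
    (mem_extChartAt_target y₀) (mem_extChartAt_target p₀)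
  have hopen : IsOpen (φ.source ∩ φ ⁻¹' U) :=
    (continuousOn_extChartAt y₀).isOpen_inter_preimage (isOpen_extChartAt_source y₀) hU
  have hφd : ∀ y ∈ φ.source, ContMDiffAt 𝓘(ℝ, E) 𝓘(ℝ, E) ∞ φ y := fun y hy ↦
    contMDiffAt_extChartAt' (by simpa [hφ] using hy)
  have hfd : ∀ u ∈ U, ContMDiffAt 𝓘(ℝ, E) 𝓘(ℝ, F) ∞ f u := fun u hu ↦
    (hfs.contDiffAt (hU.mem_nhds hu)).contMDiffAt
  have hψd : ∀ u ∈ U, ContMDiffAt 𝓘(ℝ, F) 𝓘(ℝ, F) ∞ ψ.symm (f u) := fun u hu ↦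
    contMDiffAt_extChartAt_symm_of_mem_target (hft hu)
  refine ⟨ψ.symm ∘ f ∘ φ, φ.source ∩ φ ⁻¹' U, hopen, ⟨mem_extChartAt_source y₀, hyU⟩, ?_, ?_, ?_⟩
  · change ψ.symm (f (φ y₀)) = p₀
    rw [hf0]
    exact extChartAt_to_inv p₀
  · rintro y ⟨hy, hyU⟩
    exact ((hψd _ hyU).comp y ((hfd _ hyU).comp y (hφd y hy))).contMDiffWithinAt
  · rintro y ⟨hy, hyU⟩ X
    have d1 := ((hφd y hy).mdifferentiableAt (by simp)).hasMFDerivAt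
    have d2 := ((hfd _ hyU).mdifferentiableAt (by simp)).hasMFDerivAt
    have d3 := ((hψd _ hyU).mdifferentiableAt (by simp)).hasMFDerivAt
    rw [(d3.comp y (d2.comp y d1)).mfderiv]
    change mfderiv 𝓘(ℝ, F) 𝓘(ℝ, F) ψ.symm (f (φ y)) (mfderiv 𝓘(ℝ, E) 𝓘(ℝ, F) f (φ y)
      (mfderiv 𝓘(ℝ, E) 𝓘(ℝ, E) φ y (Z X y))) = _
    rw [mfderiv_extChartAt_eq_chartFrame hy X, mfderiv_eq_fderiv]
    have := hfr _ hyU X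
    exact (congrArg _ this).trans (mfderiv_symm_chartFrame (hft hyU) X)

/-! ### Inverse function theorem on manifolds -/

/-- The inverse function theorem on manifolds: a smooth map whose derivative is everywhere
bijective is a local diffeomorphism. -/
theorem isLocalDiffeomorph_of_bijective_mfderiv
    {E : Type*} [NormedAddCommGroup E] [NormedSpace ℝ E] [CompleteSpace E]
    {M : Type*} [TopologicalSpace M] [ChartedSpace E M] [IsManifold 𝓘(ℝ, E) ∞ M]
    {F : Type*} [NormedAddCommGroup F] [NormedSpace ℝ F] [CompleteSpace F]
    {P : Type*} [TopologicalSpace P] [ChartedSpace F P] [IsManifold 𝓘(ℝ, F) ∞ P]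
    {f : M → P} (hf : ContMDiff 𝓘(ℝ, E) 𝓘(ℝ, F) ∞ f)
    (hb : ∀ y, Function.Bijective (mfderiv 𝓘(ℝ, E) 𝓘(ℝ, F) f y)) :
    IsLocalDiffeomorph 𝓘(ℝ, E) 𝓘(ℝ, F) ∞ f := by
  have : IsManifold 𝓘(ℝ, E) 1 M := IsManifold.of_le (n := ∞) (by simp)
  have : IsManifold 𝓘(ℝ, F) 1 P := IsManifold.of_le (n := ∞) (by simp)
  intro y
  set φ := extChartAt 𝓘(ℝ, E) y with hφ
  set ψ := extChartAt 𝓘(ℝ, F) (f y) with hψ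
  set s : Set E := φ.target ∩ φ.symm ⁻¹' (f ⁻¹' ψ.source) with hs
  have hso : IsOpen s := (continuousOn_extChartAt_symm y).isOpen_inter_preimage
    (isOpen_extChartAt_target y) ((isOpen_extChartAt_source (f y)).preimage hf.continuous)
  have hys : φ y ∈ s := ⟨mem_extChartAt_target y, by
    simp only [mem_preimage, hφ, extChartAt_to_inv]
    exact mem_extChartAt_source (f y)⟩
  set g : E → F := ψ ∘ f ∘ φ.symm with hg
  have hψd : ∀ p ∈ ψ.source, ContMDiffAt 𝓘(ℝ, F) 𝓘(ℝ, F) ∞ ψ p := fun p hp ↦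
    contMDiffAt_extChartAt' (by simpa [hψ] using hp)
  have hφd : ∀ p ∈ φ.source, ContMDiffAt 𝓘(ℝ, E) 𝓘(ℝ, E) ∞ φ p := fun p hp ↦
    contMDiffAt_extChartAt' (by simpa [hφ] using hp)
  have hgd : ∀ u ∈ s, ContDiffAt ℝ ∞ g u := fun u hu ↦
    ((hψd _ hu.2).comp u ((hf _).comp u
      (contMDiffAt_extChartAt_symm_of_mem_target hu.1))).contDiffAt
  have hgb : ∀ u ∈ s, ∃ g' : E ≃L[ℝ] F, HasFDerivAt g (g' : E →L[ℝ] F) u := by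
    intro u hu
    have d1 := ((contMDiffAt_extChartAt_symm_of_mem_target
      (F := E) (P := M) hu.1).mdifferentiableAt (by simp)).hasMFDerivAt
    have d2 := ((hf (φ.symm u)).mdifferentiableAt (by simp)).hasMFDerivAt
    have d3 := ((hψd _ hu.2).mdifferentiableAt (by simp)).hasMFDerivAt
    have d4 := hasMFDerivAt_iff_hasFDerivAt.1 (d3.comp u (d2.comp u d1))
    set T := (mfderiv 𝓘(ℝ, F) 𝓘(ℝ, F) ψ (f (φ.symm u))).comp
      ((mfderiv 𝓘(ℝ, E) 𝓘(ℝ, F) f (φ.symm u)).comp (mfderiv 𝓘(ℝ, E) 𝓘(ℝ, E) φ.symm u))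
    have hTb : Function.Bijective T :=
      (isInvertible_mfderiv_extChartAt hu.2).bijective.comp ((hb _).comp
        (isInvertible_mfderiv_extChartAt_symm_of_mem_target hu.1).bijective)
    exact ⟨ContinuousLinearEquiv.ofBijective (𝕜 := ℝ) (E := E) (F := F) T
      (LinearMap.ker_eq_bot.2 hTb.1) (LinearMap.range_eq_top.2 hTb.2), d4⟩
  obtain ⟨g', hg'⟩ := hgb _ hys
  -- Restricting to `s` ensures that `g` is smooth with invertible derivative at every point of the
  -- source, so the inverse is smooth on the whole target.
  set h := ((hgd _ hys).toOpenPartialHomeomorph g hg' (by simp)).restrOpen s hso with hh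
  have hcoe : ∀ u, h u = g u := fun u ↦ rfl
  have hsrc : h.source ⊆ s := fun u hu ↦ by
    rw [hh, OpenPartialHomeomorph.restrOpen_source] at hu
    exact hu.2
  have hyh : φ y ∈ h.source := by
    rw [hh, OpenPartialHomeomorph.restrOpen_source]
    exact ⟨ContDiffAt.mem_toOpenPartialHomeomorph_source _ _ _, hys⟩
  set Φ : OpenPartialHomeomorph M P :=
    ((chartAt E y).trans h).trans (chartAt F (f y)).symm with hΦ
  have hmem : ∀ z ∈ Φ.source, z ∈ φ.source ∧ φ z ∈ h.source := by
    intro z hz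
    simp only [hΦ, OpenPartialHomeomorph.trans_source, mem_inter_iff, mem_preimage] at hz
    exact ⟨by simpa [hφ] using hz.1.1, by simpa [hφ] using hz.1.2⟩
  have heq : EqOn f Φ Φ.source := by
    intro z hz
    obtain ⟨h1, h2⟩ := hmem z hz
    have h3 := (hsrc h2).2
    simp only [mem_preimage, φ.left_inv h1] at h3
    have : Φ z = ψ.symm (ψ (f (φ.symm (φ z)))) := by
      simp [hΦ, hcoe, hg, hφ, hψ]
    rw [this, φ.left_inv h1, ψ.left_inv h3]
  have hyΦ : y ∈ Φ.source := by
    simp only [hΦ, OpenPartialHomeomorph.trans_source, mem_inter_iff, mem_preimage]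
    refine ⟨⟨by simp, by simpa [hφ] using hyh⟩, ?_⟩
    have : ((chartAt E y).trans h) y = ψ (f y) := by
      simp [hcoe, hg, hψ, hφ]
    rw [this]
    simp [hψ]
  refine ⟨⟨Φ.toPartialEquiv, Φ.open_source, Φ.open_target,
    (hf.contMDiffOn).congr fun z hz ↦ (heq hz).symm, fun p hp ↦ ?_⟩, hyΦ, heq⟩
  have hp' : p ∈ Φ.target := hp
  simp only [hΦ, OpenPartialHomeomorph.trans_target, OpenPartialHomeomorph.symm_target,
    OpenPartialHomeomorph.symm_symm, mem_inter_iff, mem_preimage] at hp'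
  obtain ⟨h1, h2, h3⟩ := hp'
  have e1 : ContMDiffAt 𝓘(ℝ, F) 𝓘(ℝ, F) ∞ ψ p := hψd p (by simpa [hψ] using h1)
  have hpt : ψ p ∈ h.target := by simpa [hψ] using h2
  have hus := hsrc (h.map_target hpt)
  obtain ⟨k', hk'⟩ := hgb _ hus
  have e2 : ContMDiffAt 𝓘(ℝ, F) 𝓘(ℝ, E) ∞ h.symm (ψ p) :=
    (h.contDiffAt_symm hpt hk' (hgd _ hus)).contMDiffAt
  have e3 : ContMDiffAt 𝓘(ℝ, E) 𝓘(ℝ, E) ∞ φ.symm (h.symm (ψ p)) :=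
    contMDiffAt_extChartAt_symm_of_mem_target hus.1
  refine ContMDiffAt.contMDiffWithinAt ((e3.comp p (e2.comp p e1)).congr_of_eventuallyEq ?_)
  refine .of_forall fun q ↦ ?_
  change Φ.symm q = _
  simp [hΦ, hφ, hψ]

/-! ### Left invariant frames on a Lie group -/

section

variable {F : Type*} [NormedAddCommGroup F] [NormedSpace ℝ F]
  {G : Type*} [TopologicalSpace G] [ChartedSpace F G] [Group G] [LieGroup 𝓘(ℝ, F) ∞ G]

/-- Left invariant vector fields on a smooth Lie group are smooth. -/
theorem contMDiff_infty_mulInvariantVectorField (v : GroupLieAlgebra 𝓘(ℝ, F) G) :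
    ContMDiff 𝓘(ℝ, F) 𝓘(ℝ, F).tangent ∞
      (fun g : G ↦ (⟨g, mulInvariantVectorField v g⟩ : TangentBundle 𝓘(ℝ, F) G)) := by
  -- The field is the tangent map of multiplication applied to the pair of the zero vector at `g`
  -- and `v` at `1`.
  let fg : G → TangentBundle 𝓘(ℝ, F) G := fun g ↦ Bundle.TotalSpace.mk' F g 0
  have sfg : ContMDiff 𝓘(ℝ, F) 𝓘(ℝ, F).tangent ∞ fg := Bundle.contMDiff_zeroSection _ _
  let fv : G → TangentBundle 𝓘(ℝ, F) G := fun _ ↦ Bundle.TotalSpace.mk' F 1 v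
  have sfv : ContMDiff 𝓘(ℝ, F) 𝓘(ℝ, F).tangent ∞ fv := contMDiff_const
  let F₂ : (TangentBundle 𝓘(ℝ, F) G × TangentBundle 𝓘(ℝ, F) G) →
      TangentBundle (𝓘(ℝ, F).prod 𝓘(ℝ, F)) (G × G) :=
    (equivTangentBundleProd 𝓘(ℝ, F) G 𝓘(ℝ, F) G).symm
  have S₂ : ContMDiff (𝓘(ℝ, F).tangent.prod 𝓘(ℝ, F).tangent)
      (𝓘(ℝ, F).prod 𝓘(ℝ, F)).tangent ∞ F₂ := contMDiff_equivTangentBundleProd_symm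
  let F₃ : TangentBundle (𝓘(ℝ, F).prod 𝓘(ℝ, F)) (G × G) → TangentBundle 𝓘(ℝ, F) G :=
    tangentMap (𝓘(ℝ, F).prod 𝓘(ℝ, F)) 𝓘(ℝ, F) (fun p : G × G ↦ p.1 * p.2)
  have S₃ : ContMDiff (𝓘(ℝ, F).prod 𝓘(ℝ, F)).tangent 𝓘(ℝ, F).tangent ∞ F₃ :=
    ContMDiff.contMDiff_tangentMap (contMDiff_mul 𝓘(ℝ, F) ∞) (by simp)
  have S := (S₃.comp S₂).comp (sfg.prodMk sfv)
  refine S.congr fun g ↦ ?_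
  have hmul : MDifferentiable (𝓘(ℝ, F).prod 𝓘(ℝ, F)) 𝓘(ℝ, F) (fun p : G × G ↦ p.1 * p.2) :=
    (contMDiff_mul 𝓘(ℝ, F) ∞).mdifferentiable (by simp)
  have h1 : mfderiv (𝓘(ℝ, F).prod 𝓘(ℝ, F)) 𝓘(ℝ, F) (fun p : G × G ↦ p.1 * p.2) (g, 1)
      ((0 : F), (v : F)) =
      mfderiv 𝓘(ℝ, F) 𝓘(ℝ, F) (fun k : G ↦ k * 1) g (0 : F) +
      mfderiv 𝓘(ℝ, F) 𝓘(ℝ, F) (fun k : G ↦ g * k) 1 v :=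
    mfderiv_prod_eq_add_apply (hmul _)
  have h2 : mfderiv 𝓘(ℝ, F) 𝓘(ℝ, F) (fun k : G ↦ k * 1) g (0 : F) = 0 :=
    map_zero (mfderiv 𝓘(ℝ, F) 𝓘(ℝ, F) (fun k : G ↦ k * 1) g)
  have h3 : (mfderiv (𝓘(ℝ, F).prod 𝓘(ℝ, F)) 𝓘(ℝ, F) (fun p : G × G ↦ p.1 * p.2) (g, 1)
      ((0 : F), (v : F)) : F) = mulInvariantVectorField v g :=
    h1.trans ((congrArg (· + _) h2).trans (zero_add (_ : F)))
  have h4 : ∀ (a b : G) (w w' : F), a = b → w = w' →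
      (⟨a, w⟩ : TangentBundle 𝓘(ℝ, F) G) = ⟨b, w'⟩ := by
    rintro a _ w _ rfl rfl; rfl
  exact h4 _ _ _ _ (mul_one g).symm h3.symm

variable (F G) in
/-- The left invariant vector fields, as a linear family parametrized by the model space. -/
noncomputable def mulInvariantFrame : F →ₗ[ℝ] (Π g : G, TangentSpace 𝓘(ℝ, F) g) where
  toFun X := mulInvariantVectorField (X : GroupLieAlgebra 𝓘(ℝ, F) G)
  map_add' X Y := mulInvariantVectorField_add (X : GroupLieAlgebra 𝓘(ℝ, F) G) Y
  map_smul' a X := mulInvariantVectorField_smul a (X : GroupLieAlgebra 𝓘(ℝ, F) G)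

theorem mlieBracket_mulInvariantVectorField [CompleteSpace F]
    (X Y : GroupLieAlgebra 𝓘(ℝ, F) G) :
    VectorField.mlieBracket 𝓘(ℝ, F) (mulInvariantVectorField X) (mulInvariantVectorField Y) =
      mulInvariantVectorField (⁅X, Y⁆ : GroupLieAlgebra 𝓘(ℝ, F) G) :=
  (mulInvariantVector_mlieBracket X Y).symm

theorem mfderiv_mul_left_injective (g h : G) :
    Function.Injective (mfderiv 𝓘(ℝ, F) 𝓘(ℝ, F) (fun k : G ↦ g * k) h) := by
  have hfun : (fun k : G ↦ g⁻¹ * k) ∘ (fun k : G ↦ g * k) = id := by ext k; simp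
  have key := mfderiv_comp (I := 𝓘(ℝ, F)) (I' := 𝓘(ℝ, F)) (I'' := 𝓘(ℝ, F)) h
    (mdifferentiable_mul_left_lieGroup (F := F) g⁻¹ (g * h))
    (mdifferentiable_mul_left_lieGroup (F := F) g h)
  rw [hfun, mfderiv_id] at key
  refine Function.LeftInverse.injective
    (g := mfderiv 𝓘(ℝ, F) 𝓘(ℝ, F) (fun k : G ↦ g⁻¹ * k) (g * h)) fun v ↦ ?_
  exact (congrArg (fun A : TangentSpace 𝓘(ℝ, F) h →L[ℝ] _ ↦ A v) key).symm

/-- Left invariant vector fields form a frame. -/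
theorem mulInvariantVectorField_bijective [FiniteDimensional ℝ F] (g : G) :
    Function.Bijective fun X : GroupLieAlgebra 𝓘(ℝ, F) G ↦ mulInvariantVectorField X g := by
  have hinj := mfderiv_mul_left_injective (F := F) g (1 : G)
  refine ⟨hinj, ?_⟩
  let T : F →L[ℝ] F := mfderiv 𝓘(ℝ, F) 𝓘(ℝ, F) (fun k : G ↦ g * k) 1
  have hT : Function.Injective T := hinj
  exact (LinearMap.injective_iff_surjective (f := T.toLinearMap)).1 hT

end

/-! ### The developing map -/

namespace LieAlgebraAction

variable {𝔤 : Type*} [LieRing 𝔤] [LieAlgebra ℝ 𝔤]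
  {E : Type*} [NormedAddCommGroup E] [NormedSpace ℝ E]
  {M : Type*} [TopologicalSpace M] [ChartedSpace E M] [IsManifold 𝓘(ℝ, E) ∞ M]
  {F : Type*} [NormedAddCommGroup F] [NormedSpace ℝ F] [CompleteSpace F]
  {G : Type*} [TopologicalSpace G] [ChartedSpace F G] [Group G] [LieGroup 𝓘(ℝ, F) ∞ G]

/-- The fundamental vector fields, as a linear family parametrized by the model space of `G`. -/
noncomputable def frame (ζ : LieAlgebraAction 𝔤 E M) (e : 𝔤 ≃ₗ⁅ℝ⁆ GroupLieAlgebra 𝓘(ℝ, F) G) :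
    F →ₗ[ℝ] (Π y : M, TangentSpace 𝓘(ℝ, E) y) where
  toFun X := ζ.field (e.symm (X : GroupLieAlgebra 𝓘(ℝ, F) G))
  map_add' X Y := by
    have : e.symm ((X + Y : F) : GroupLieAlgebra 𝓘(ℝ, F) G) =
      e.symm (X : GroupLieAlgebra 𝓘(ℝ, F) G) + e.symm (Y : GroupLieAlgebra 𝓘(ℝ, F) G) :=
      map_add e.symm _ _
    rw [this, map_add]
  map_smul' a X := by
    have : e.symm ((a • X : F) : GroupLieAlgebra 𝓘(ℝ, F) G) =
      a • e.symm (X : GroupLieAlgebra 𝓘(ℝ, F) G) := map_smul e.symm _ _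
    rw [this, map_smul, RingHom.id_apply]

/-- For a transitive action, the `𝔤`-valued one-form dual to the fundamental vector fields. -/
noncomputable def coframe (ζ : LieAlgebraAction 𝔤 E M)
    (e : 𝔤 ≃ₗ⁅ℝ⁆ GroupLieAlgebra 𝓘(ℝ, F) G) (htrans : ζ.IsTransitive) (y : M)
    (v : TangentSpace 𝓘(ℝ, E) y) : GroupLieAlgebra 𝓘(ℝ, F) G :=
  e (Function.surjInv (htrans y) v)

/-- By transitivity every tangent vector at `y` is some `ζ_X(y)`, so equivariance at `y` fixes the
whole derivative and the uniqueness results for logarithmic derivatives apply. -/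
theorem hasLogDerivAt_coframe {ζ : LieAlgebraAction 𝔤 E M}
    {e : 𝔤 ≃ₗ⁅ℝ⁆ GroupLieAlgebra 𝓘(ℝ, F) G} (htrans : ζ.IsTransitive) {f : M → G} {y : M}
    (hf : MDifferentiableAt 𝓘(ℝ, E) 𝓘(ℝ, F) f y)
    (hr : ∀ X, mfderiv 𝓘(ℝ, E) 𝓘(ℝ, F) f y (ζ.field X y) =
      mulInvariantVectorField (e X) (f y)) :
    HasLogDerivAt f (ζ.coframe e htrans y) := by
  refine ⟨hf, fun v ↦ ?_⟩
  have h := hr (Function.surjInv (htrans y) v)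
  have h2 : ζ.field (Function.surjInv (htrans y) v) y = v := Function.surjInv_eq (htrans y) v
  rwa [h2] at h

theorem IsEquivariant.hasLogDerivAt {ζ : LieAlgebraAction 𝔤 E M}
    {e : 𝔤 ≃ₗ⁅ℝ⁆ GroupLieAlgebra 𝓘(ℝ, F) G} (htrans : ζ.IsTransitive) {f : M → G}
    (hf : ζ.IsEquivariant e f) (y : M) : HasLogDerivAt f (ζ.coframe e htrans y) :=
  hasLogDerivAt_coframe htrans (hf.smooth.mdifferentiableAt (by simp)) fun X ↦ hf.related X y

/-- Equivariant maps on a connected manifold are determined by their value at a point. -/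
theorem IsEquivariant.eq_of_apply_eq [PreconnectedSpace M] {ζ : LieAlgebraAction 𝔤 E M}
    {e : 𝔤 ≃ₗ⁅ℝ⁆ GroupLieAlgebra 𝓘(ℝ, F) G} (htrans : ζ.IsTransitive) {f₁ f₂ : M → G}
    (h₁ : ζ.IsEquivariant e f₁) (h₂ : ζ.IsEquivariant e f₂) {x : M} (h : f₁ x = f₂ x) :
    f₁ = f₂ := by
  have : IsManifold 𝓘(ℝ, E) 1 M := IsManifold.of_le (n := ∞) (by simp)
  exact eq_of_hasLogDerivAt (h₁.hasLogDerivAt htrans) (h₂.hasLogDerivAt htrans) h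

/-- A free and transitive action of the Lie algebra of a Lie group is locally developed by an
equivariant map with a prescribed value at a point. -/
theorem exists_local_equivariant [FiniteDimensional ℝ F] [CompleteSpace E]
    (ζ : LieAlgebraAction 𝔤 E M)
    (e : 𝔤 ≃ₗ⁅ℝ⁆ GroupLieAlgebra 𝓘(ℝ, F) G) (hfree : ζ.IsFree) (htrans : ζ.IsTransitive)
    (y₀ : M) (g₀ : G) :
    ∃ (f : M → G) (U : Set M), IsOpen U ∧ y₀ ∈ U ∧ f y₀ = g₀ ∧
      ContMDiffOn 𝓘(ℝ, E) 𝓘(ℝ, F) ∞ f U ∧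
      ∀ y ∈ U, ∀ X, mfderiv 𝓘(ℝ, E) 𝓘(ℝ, F) f y (ζ.field X y) =
        mulInvariantVectorField (e X) (f y) := by
  obtain ⟨f, U, hU, hy, hf, hs, hr⟩ := exists_contMDiffOn_related (Z := ζ.frame e)
    (A := mulInvariantFrame F G)
    (c := fun (X Y : GroupLieAlgebra 𝓘(ℝ, F) G) ↦ (⁅X, Y⁆ : GroupLieAlgebra 𝓘(ℝ, F) G))
    (fun X ↦ ζ.smooth _) (fun X ↦ contMDiff_infty_mulInvariantVectorField _)
    (fun X Y ↦ by
      have (X Y : GroupLieAlgebra 𝓘(ℝ, F) G) : e.symm ⁅X, Y⁆ = ⁅e.symm X, e.symm Y⁆ :=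
        LieEquiv.map_lie e.symm X Y
      exact ((congrArg ζ.field (this X Y)).trans (ζ.map_lie _ _)).symm)
    (fun X Y ↦ mlieBracket_mulInvariantVectorField _ _)
    (fun y ↦ ⟨(hfree y).comp e.symm.injective, (htrans y).comp e.symm.surjective⟩) y₀ g₀
  refine ⟨f, U, hU, hy, hf, hs, fun y hy X ↦ ?_⟩
  have h := hr y hy (e X : F)
  have h2 : e.symm (e X) = X := e.symm_apply_apply X
  have h3 : (ζ.frame e (e X : F)) y = ζ.field X y := by
    change ζ.field (e.symm (e X)) y = _
    rw [h2]
  rw [h3] at h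
  exact h

/-- The developing map of a free and transitive action of the Lie algebra of a Lie group on a
simply connected manifold. -/
theorem exists_isEquivariant [FiniteDimensional ℝ F] [FiniteDimensional ℝ E]
    [SimplyConnectedSpace M] (ζ : LieAlgebraAction 𝔤 E M)
    (e : 𝔤 ≃ₗ⁅ℝ⁆ GroupLieAlgebra 𝓘(ℝ, F) G) (hfree : ζ.IsFree) (htrans : ζ.IsTransitive) (x : M) :
    ∃ C : M → G, ζ.IsEquivariant e C ∧ C x = 1 := by
  have : IsManifold 𝓘(ℝ, E) 1 M := IsManifold.of_le (n := ∞) (by simp)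
  have : CompleteSpace E := FiniteDimensional.complete ℝ E
  have : LocallyPathConnectedSpace M := ChartedSpace.locallyPathConnectedSpace E M
  choose f U hU hmem _ hs hr using fun i ↦ ζ.exists_local_equivariant e hfree htrans i 1
  have hd : ∀ i, ∀ y ∈ U i, ContMDiffAt 𝓘(ℝ, E) 𝓘(ℝ, F) ∞ (f i) y := fun i y hy ↦
    (hs i).contMDiffAt ((hU i).mem_nhds hy)
  have hlog : ∀ i, ∀ y ∈ U i, HasLogDerivAt (f i) (ζ.coframe e htrans y) := fun i y hy ↦
    hasLogDerivAt_coframe htrans ((hd i y hy).mdifferentiableAt (by simp)) (hr i y hy)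
  obtain ⟨C, hCx, hC⟩ := exists_glue_of_ratio_eventually_const hU hmem f
    (fun i j y hy ↦ eventually_mul_inv_eq_of_hasLogDerivAt
      (eventually_of_mem ((hU i).mem_nhds hy.1) (hlog i))
      (eventually_of_mem ((hU j).mem_nhds hy.2) (hlog j))) x 1
  -- Locally `C` is a left translate of a local solution; left translations preserve each `L_X`, so
  -- smoothness and equivariance carry over.
  have hloc : ∀ y, ∃ k : G, C =ᶠ[𝓝 y] fun z ↦ k * f y z := fun y ↦
    ⟨C y * (f y y)⁻¹, (hC y y (hmem y)).mono fun z hz ↦ by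
      simp only [← hz, inv_mul_cancel_right]⟩
  refine ⟨C, ⟨fun y ↦ ?_, fun X y ↦ ?_⟩, hCx⟩
  · obtain ⟨k, hk⟩ := hloc y
    exact (((contMDiff_mul_left (I := 𝓘(ℝ, F)) (n := ∞) (a := k)).contMDiffAt).comp y
      (hd y y (hmem y))).congr_of_eventuallyEq hk
  · obtain ⟨k, hk⟩ := hloc y
    have h1 := (mdifferentiable_mul_left_lieGroup (F := F) k (f y y)).hasMFDerivAt.comp y
      ((hd y y (hmem y)).mdifferentiableAt (by simp)).hasMFDerivAt
    rw [hk.mfderiv_eq]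
    have h2 := congrArg (fun T : E →L[ℝ] F ↦ T (ζ.field X y)) h1.mfderiv
    have h3 : (mfderiv 𝓘(ℝ, F) 𝓘(ℝ, F) (fun h : G ↦ k * h) (f y y)
        (mfderiv 𝓘(ℝ, E) 𝓘(ℝ, F) (f y) y (ζ.field X y)) : F) =
        mulInvariantVectorField (e X) (k * f y y) := by
      rw [hr y y (hmem y) X]
      exact mfderiv_mul_left_mulInvariantVectorField k (f y y) (e X)
    have h4 : (mulInvariantVectorField (e X) (k * f y y) : F) =
      mulInvariantVectorField (e X) (C y) := by rw [hk.self_of_nhds]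
    exact (h2.trans h3).trans h4

end LieAlgebraAction

/-! ### The leaf as the graph of the developing map -/

/-- A manifold structure can be transported along a homeomorphism and a continuous linear
equivalence of model spaces. -/
theorem Homeomorph.exists_chartedSpace_contMDiff
    {E : Type*} [NormedAddCommGroup E] [NormedSpace ℝ E]
    {M : Type*} [TopologicalSpace M] [ChartedSpace E M] [IsManifold 𝓘(ℝ, E) ∞ M]
    {F : Type*} [NormedAddCommGroup F] [NormedSpace ℝ F]
    {N : Type*} [TopologicalSpace N] (φ : N ≃ₜ M) (A : E ≃L[ℝ] F) :
    ∃ _ : ChartedSpace F N, IsManifold 𝓘(ℝ, F) ∞ N ∧ ContMDiff 𝓘(ℝ, F) 𝓘(ℝ, E) ∞ φ ∧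
      ContMDiff 𝓘(ℝ, E) 𝓘(ℝ, F) ∞ φ.symm := by
  let T : OpenPartialHomeomorph M E → OpenPartialHomeomorph N F := fun c ↦
    (φ.toOpenPartialHomeomorph.trans c).trans A.toHomeomorph.toOpenPartialHomeomorph
  have hTs : ∀ c n, n ∈ (T c).source ↔ φ n ∈ c.source := fun c n ↦ by simp [T]
  let cs : ChartedSpace F N :=
    { atlas := T '' atlas E M
      chartAt := fun n ↦ T (chartAt E (φ n))
      mem_chart_source := fun n ↦ (hTs _ _).2 (mem_chart_source E (φ n))
      chart_mem_atlas := fun n ↦ mem_image_of_mem T (chart_mem_atlas E (φ n)) }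
  have hA : ContDiff ℝ ∞ A := A.contDiff
  have hA' : ContDiff ℝ ∞ A.symm := A.symm.contDiff
  have hman : IsManifold 𝓘(ℝ, F) ∞ N := by
    refine isManifold_of_contDiffOn _ _ _ ?_
    rintro _ _ ⟨c, hc, rfl⟩ ⟨c', hc', rfl⟩
    have h1 : ContDiffOn ℝ ∞ (c' ∘ c.symm) (c.target ∩ c.symm ⁻¹' c'.source) :=
      ((contMDiffOn_of_mem_maximalAtlas (I := 𝓘(ℝ, E)) (n := ∞)
        (IsManifold.subset_maximalAtlas hc')).comp
        ((contMDiffOn_symm_of_mem_maximalAtlas (I := 𝓘(ℝ, E)) (n := ∞)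
          (IsManifold.subset_maximalAtlas hc)).mono inter_subset_left)
        fun u hu ↦ hu.2).contDiffOn
    have h2 := hA.comp_contDiffOn (h1.comp hA'.contDiffOn (s := A.symm ⁻¹' _)
      fun u hu ↦ hu)
    refine (h2.mono fun u hu ↦ ?_).congr fun u hu ↦ ?_
    · simpa [T] using hu
    · simp [T]
  refine ⟨cs, hman, fun n ↦ ?_, fun m ↦ ?_⟩
  · have h1 : ContMDiffAt 𝓘(ℝ, F) 𝓘(ℝ, F) ∞ (T (chartAt E (φ n))) n :=
      (contMDiffOn_chart (I := 𝓘(ℝ, F)) (x := n)).contMDiffAt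
        ((chartAt F n).open_source.mem_nhds (mem_chart_source F n))
    have h2 : ContMDiffAt 𝓘(ℝ, E) 𝓘(ℝ, E) ∞ (chartAt E (φ n)).symm
        (A.symm (T (chartAt E (φ n)) n)) := by
      refine (contMDiffOn_chart_symm (I := 𝓘(ℝ, E)) (x := φ n)).contMDiffAt
        ((chartAt E (φ n)).open_target.mem_nhds ?_)
      simp [T]
    refine ((h2.comp n (hA'.contMDiff.contMDiffAt.comp n h1))).congr_of_eventuallyEq ?_
    filter_upwards [(chartAt F n).open_source.mem_nhds (mem_chart_source F n)] with z hz
    have hz' : φ z ∈ (chartAt E (φ n)).source := (hTs _ _).1 hz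
    simp [T, hz']
  · have h1 : ContMDiffAt 𝓘(ℝ, E) 𝓘(ℝ, E) ∞ (chartAt E m) m :=
      (contMDiffOn_chart (I := 𝓘(ℝ, E)) (x := m)).contMDiffAt
        ((chartAt E m).open_source.mem_nhds (mem_chart_source E m))
    have hchart : chartAt F (φ.symm m) = T (chartAt E m) := by
      change T (chartAt E (φ (φ.symm m))) = _
      rw [φ.apply_symm_apply]
    have h2 : ContMDiffAt 𝓘(ℝ, F) 𝓘(ℝ, F) ∞ (T (chartAt E m)).symm (A (chartAt E m m)) := by
      rw [← hchart]
      refine (contMDiffOn_chart_symm (I := 𝓘(ℝ, F)) (x := φ.symm m)).contMDiffAt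
        ((chartAt F (φ.symm m)).open_target.mem_nhds ?_)
      rw [hchart]
      simp [T]
    refine ((h2.comp m (hA.contMDiff.contMDiffAt.comp m h1))).congr_of_eventuallyEq ?_
    filter_upwards [(chartAt E m).open_source.mem_nhds (mem_chart_source E m)] with z hz
    simp [T, hz]

namespace LieAlgebraAction

variable {𝔤 : Type*} [LieRing 𝔤] [LieAlgebra ℝ 𝔤]
  {E : Type*} [NormedAddCommGroup E] [NormedSpace ℝ E]
  {M : Type*} [TopologicalSpace M] [ChartedSpace E M] [IsManifold 𝓘(ℝ, E) ∞ M]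
  {F : Type*} [NormedAddCommGroup F] [NormedSpace ℝ F] [CompleteSpace F]
  {G : Type*} [TopologicalSpace G] [ChartedSpace F G] [Group G] [LieGroup 𝓘(ℝ, F) ∞ G]
  {ζ : LieAlgebraAction 𝔤 E M} {e : 𝔤 ≃ₗ⁅ℝ⁆ GroupLieAlgebra 𝓘(ℝ, F) G}

/-- Points of the leaf of the graph distribution through a point of the graph of an equivariant
map belong to this graph. -/
theorem IsEquivariant.eq_of_mem_leafThrough {C : M → G} (hC : ζ.IsEquivariant e C) {x : M}
    {q : G × M}
    (hq : q ∈ leafThrough F (𝓘(ℝ, F).prod 𝓘(ℝ, E)) (ζ.graphDistribution e) (C x, x)) :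
    C q.2 = q.1 := by
  obtain ⟨N, _, _, _, _, j, hj, ⟨n, hn⟩, ⟨m, rfl⟩⟩ := hq
  have hjd : ∀ k, MDifferentiableAt 𝓘(ℝ, F) (𝓘(ℝ, F).prod 𝓘(ℝ, E)) j k := fun k ↦
    hj.smooth.mdifferentiableAt (by simp)
  have h1 : ∀ k, HasMFDerivAt 𝓘(ℝ, F) 𝓘(ℝ, F) (fun k ↦ (j k).1) k
      ((ContinuousLinearMap.fst ℝ F E).comp
        (mfderiv 𝓘(ℝ, F) (𝓘(ℝ, F).prod 𝓘(ℝ, E)) j k : F →L[ℝ] F × E)) := fun k ↦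
    (hasMFDerivAt_fst (I := 𝓘(ℝ, F)) (I' := 𝓘(ℝ, E)) (j k)).comp k (hjd k).hasMFDerivAt
  have h2 : ∀ k, HasMFDerivAt 𝓘(ℝ, F) 𝓘(ℝ, E) (fun k ↦ (j k).2) k
      ((ContinuousLinearMap.snd ℝ F E).comp
        (mfderiv 𝓘(ℝ, F) (𝓘(ℝ, F).prod 𝓘(ℝ, E)) j k : F →L[ℝ] F × E)) := fun k ↦
    (hasMFDerivAt_snd (I := 𝓘(ℝ, F)) (I' := 𝓘(ℝ, E)) (j k)).comp k (hjd k).hasMFDerivAt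
  have hX : ∀ (k : N) (v : TangentSpace 𝓘(ℝ, F) k), ∃ X : 𝔤,
      ((mulInvariantVectorField (e X) (j k).1 : F), (ζ.field X (j k).2 : E)) =
        (mfderiv 𝓘(ℝ, F) (𝓘(ℝ, F).prod 𝓘(ℝ, E)) j k v : F × E) := by
    intro k v
    have : mfderiv 𝓘(ℝ, F) (𝓘(ℝ, F).prod 𝓘(ℝ, E)) j k v ∈ ζ.graphDistribution e (j k) := by
      rw [← hj.tangent k]; exact mem_range_self v
    exact this
  -- A pointwise choice suffices: the uniqueness argument needs no regularity or linearity of `X` in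
  -- `k` and `v`.
  choose X hX using hX
  have l1 : ∀ k, HasLogDerivAt (fun k ↦ (j k).1) (fun v ↦ e (X k v)) := fun k ↦
    ⟨(h1 k).mdifferentiableAt, fun v ↦ by
      rw [(h1 k).mfderiv]
      exact (congrArg Prod.fst (hX k v)).symm⟩
  have l2 : ∀ k, HasLogDerivAt (fun k ↦ C (j k).2) (fun v ↦ e (X k v)) := fun k ↦ by
    have h3 := ((hC.smooth.mdifferentiableAt (by simp)).hasMFDerivAt (x := (j k).2)).comp k (h2 k)
    refine ⟨h3.mdifferentiableAt, fun v ↦ ?_⟩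
    have h4 : mfderiv 𝓘(ℝ, F) 𝓘(ℝ, F) (fun k ↦ C (j k).2) k v =
      mfderiv 𝓘(ℝ, E) 𝓘(ℝ, F) C (j k).2
        (mfderiv 𝓘(ℝ, F) (𝓘(ℝ, F).prod 𝓘(ℝ, E)) j k v : F × E).2 :=
      congrArg (fun T : F →L[ℝ] F ↦ T v) h3.mfderiv
    rw [h4, ← hX k v]
    exact hC.related (X k v) (j k).2
  have : IsManifold 𝓘(ℝ, F) 1 N := IsManifold.of_le (n := ∞) (by simp)
  exact congrFun (eq_of_hasLogDerivAt l2 l1 (n := n) (by simp [hn])) m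

/-- The graph of an equivariant map on a connected manifold is contained in a leaf. -/
theorem IsEquivariant.mem_leafThrough [FiniteDimensional ℝ E] [ConnectedSpace M] {C : M → G}
    (hC : ζ.IsEquivariant e C) (hfree : ζ.IsFree) (htrans : ζ.IsTransitive) (x y : M) :
    (C y, y) ∈ leafThrough F (𝓘(ℝ, F).prod 𝓘(ℝ, E)) (ζ.graphDistribution e) (C x, x) := by
  -- An integral manifold in `leafThrough` must be modelled on `F` and live in the universe of `G ×
  -- M`. So `M` is replaced by `ULift M`, with charts transported through `E ≃ 𝔤 ≃ F`, the first map
  -- being the inverse of evaluation at `x`.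
  let B : 𝔤 ≃ₗ[ℝ] E := LinearEquiv.ofBijective
    ({ toFun := fun X ↦ ζ.field X x
       map_add' := fun X Y ↦ by rw [map_add]; rfl
       map_smul' := fun a X ↦ by rw [map_smul]; rfl } : 𝔤 →ₗ[ℝ] E) ⟨hfree x, htrans x⟩
  let B' : 𝔤 ≃ₗ[ℝ] F := e.toLinearEquiv
  have A : E ≃L[ℝ] F := (B.symm.trans B').toContinuousLinearEquiv
  let φ : ULift M ≃ₜ M := Homeomorph.ulift
  obtain ⟨_, hman, hφ, hφ'⟩ := φ.exists_chartedSpace_contMDiff A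
  have hconn : ConnectedSpace (ULift M) := φ.symm.surjective.connectedSpace φ.symm.continuous
  have hCφ : ContMDiff 𝓘(ℝ, F) 𝓘(ℝ, F) ∞ fun n ↦ C (φ n) := hC.smooth.comp hφ
  have hbij : ∀ n, Function.Bijective (mfderiv 𝓘(ℝ, F) 𝓘(ℝ, E) φ n) := by
    intro n
    let D : Diffeomorph 𝓘(ℝ, F) 𝓘(ℝ, E) (ULift M) M ∞ := ⟨φ.toEquiv, hφ, hφ'⟩
    exact (D.mfderivToContinuousLinearEquiv (by simp) n).bijective
  have hder : ∀ n v, (mfderiv 𝓘(ℝ, F) (𝓘(ℝ, F).prod 𝓘(ℝ, E)) (fun n ↦ (C (φ n), φ n)) n v : F × E)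
      = (mfderiv 𝓘(ℝ, E) 𝓘(ℝ, F) C (φ n) (mfderiv 𝓘(ℝ, F) 𝓘(ℝ, E) φ n v),
        mfderiv 𝓘(ℝ, F) 𝓘(ℝ, E) φ n v) := by
    intro n v
    have h1 := (hφ.mdifferentiableAt (by simp)).hasMFDerivAt (x := n)
    have h2 := ((hC.smooth.mdifferentiableAt (by simp)).hasMFDerivAt (x := φ n)).comp n h1
    exact congrArg (fun T : F →L[ℝ] F × E ↦ T v) (h2.prodMk h1).mfderiv
  refine ⟨ULift M, inferInstance, _, hman, hconn, fun n ↦ (C (φ n), φ n),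
    ⟨fun a b h ↦ φ.injective (Prod.mk.inj h).2, hCφ.prodMk hφ, fun n v w h ↦ ?_, fun n ↦ ?_⟩,
    ⟨φ.symm x, by simp⟩, ⟨φ.symm y, by simp⟩⟩
  · exact (hbij n).1 (congrArg Prod.snd ((hder n v).symm.trans (h.trans (hder n w))))
  · have hrel : ∀ X : 𝔤, mfderiv 𝓘(ℝ, E) 𝓘(ℝ, F) C (φ n) (ζ.field X (φ n)) =
      mulInvariantVectorField (e X) (C (φ n)) := fun X ↦ hC.related X (φ n)
    apply Subset.antisymm
    · rintro _ ⟨v, rfl⟩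
      obtain ⟨X, hX⟩ := htrans (φ n) (mfderiv 𝓘(ℝ, F) 𝓘(ℝ, E) φ n v)
      refine ⟨X, ?_⟩
      refine Eq.trans ?_ (hder n v).symm
      have hX' : ζ.field X (φ n) = mfderiv 𝓘(ℝ, F) 𝓘(ℝ, E) φ n v := hX
      rw [← hX']
      exact Prod.ext (hrel X).symm rfl
    · rintro _ ⟨X, rfl⟩
      obtain ⟨v, hv⟩ := (hbij n).2 (ζ.field X (φ n))
      refine ⟨v, (hder n v).trans ?_⟩
      rw [hv]
      exact Prod.ext (hrel X) rfl

theorem IsEquivariant.developingDomain_eq_range [FiniteDimensional ℝ E] [ConnectedSpace M]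
    {C : M → G} (hC : ζ.IsEquivariant e C) (hfree : ζ.IsFree) (htrans : ζ.IsTransitive) {x : M}
    (hx : C x = 1) : ζ.developingDomain e x = range C := by
  rw [developingDomain, ← hx]
  ext g
  constructor
  · rintro ⟨q, hq, rfl⟩
    exact ⟨q.2, hC.eq_of_mem_leafThrough hq⟩
  · rintro ⟨y, rfl⟩
    exact ⟨_, hC.mem_leafThrough hfree htrans x y, rfl⟩

/-- The derivative carries the frame `ζ_X` to the frame `L_X`, so it is bijective at every point. -/
theorem IsEquivariant.isLocalDiffeomorph [FiniteDimensional ℝ E] [FiniteDimensional ℝ F]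
    {C : M → G} (hC : ζ.IsEquivariant e C) (hfree : ζ.IsFree) (htrans : ζ.IsTransitive) :
    IsLocalDiffeomorph 𝓘(ℝ, E) 𝓘(ℝ, F) ∞ C := by
  have : CompleteSpace E := FiniteDimensional.complete ℝ E
  refine isLocalDiffeomorph_of_bijective_mfderiv hC.smooth fun y ↦ ?_
  have h1 : Function.Bijective fun X : 𝔤 ↦ mfderiv 𝓘(ℝ, E) 𝓘(ℝ, F) C y (ζ.field X y) := by
    simp only [hC.related]
    exact (mulInvariantVectorField_bijective (F := F) (C y)).comp e.bijective
  exact (Function.Bijective.of_comp_iff _ (⟨hfree y, htrans y⟩ : Function.Bijective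
    fun X : 𝔤 ↦ ζ.field X y)).1 h1

/-! ### Integrated actions -/

section Integrated

variable {ρ : M → G → M}

theorem IsIntegratedBy.contMDiff_orbit (hρ : ζ.IsIntegratedBy e ρ) (x : M) :
    ContMDiff 𝓘(ℝ, F) 𝓘(ℝ, E) ∞ (ρ x) :=
  hρ.smooth.comp (contMDiff_const.prodMk contMDiff_id)

/-- Left invariant vector fields and fundamental vector fields are related by orbit maps. -/
theorem IsIntegratedBy.mfderiv_orbit (hρ : ζ.IsIntegratedBy e ρ) (x : M) (g : G) (X : 𝔤) :
    mfderiv 𝓘(ℝ, F) 𝓘(ℝ, E) (ρ x) g (mulInvariantVectorField (e X) g) =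
      ζ.field X (ρ x g) := by
  have hd := fun y ↦ (hρ.contMDiff_orbit y).mdifferentiable (by simp)
  have hfun : ρ x ∘ (fun h ↦ g * h) = ρ (ρ x g) := by
    ext h; exact hρ.act_mul x g h
  have key := mfderiv_comp (I := 𝓘(ℝ, F)) (I' := 𝓘(ℝ, F)) (I'' := 𝓘(ℝ, E)) (1 : G)
    (hd x (g * 1)) (mdifferentiable_mul_left_lieGroup (F := F) g 1)
  rw [hfun] at key
  have aux : ∀ k : G, k = g * 1 →
      (mfderiv 𝓘(ℝ, F) 𝓘(ℝ, E) (ρ x) k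
        (mfderiv 𝓘(ℝ, F) 𝓘(ℝ, F) (fun k : G ↦ g * k) 1 (e X) : F) : E) =
        mfderiv 𝓘(ℝ, F) 𝓘(ℝ, E) (ρ (ρ x g)) 1 (e X) := by
    rintro _ rfl
    exact (congrArg (fun A : TangentSpace 𝓘(ℝ, F) (1 : G) →L[ℝ] _ ↦ A (e X)) key).symm
  have h2 : (ζ.field X (ρ (ρ x g) 1) : E) = ζ.field X (ρ x g) := by rw [hρ.act_one]
  exact ((aux g (mul_one g).symm).trans (hρ.fundamental X (ρ x g))).trans h2

theorem IsEquivariant.mfderiv_comp_orbit {C : M → G} (hC : ζ.IsEquivariant e C)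
    (hρ : ζ.IsIntegratedBy e ρ) (x : M) (g : G) (X : 𝔤) :
    mfderiv 𝓘(ℝ, F) 𝓘(ℝ, F) (fun h ↦ C (ρ x h)) g (mulInvariantVectorField (e X) g) =
      mulInvariantVectorField (e X) (C (ρ x g)) := by
  have h := ((hC.smooth.mdifferentiableAt (by simp)).hasMFDerivAt (x := ρ x g)).comp g
    (((hρ.contMDiff_orbit x).mdifferentiableAt (by simp)).hasMFDerivAt)
  have h2 : mfderiv 𝓘(ℝ, F) 𝓘(ℝ, F) (fun h ↦ C (ρ x h)) g (mulInvariantVectorField (e X) g) =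
      mfderiv 𝓘(ℝ, E) 𝓘(ℝ, F) C (ρ x g)
        (mfderiv 𝓘(ℝ, F) 𝓘(ℝ, E) (ρ x) g (mulInvariantVectorField (e X) g)) :=
    congrArg (fun T : F →L[ℝ] F ↦ T (mulInvariantVectorField (e X) g)) h.mfderiv
  rw [h2, hρ.mfderiv_orbit]
  exact hC.related X (ρ x g)

/-- When `C x = 1`, this second equivariant map also takes the value `1` at `x`; on a connected `M`,
uniqueness for a transitive action then identifies it with `C`. -/
theorem IsEquivariant.comp_orbit {C : M → G} (hC : ζ.IsEquivariant e C)
    (hρ : ζ.IsIntegratedBy e ρ) (x : M) : ζ.IsEquivariant e fun y ↦ C (ρ x (C y)) := by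
  have hs : ContMDiff 𝓘(ℝ, F) 𝓘(ℝ, F) ∞ fun h ↦ C (ρ x h) :=
    hC.smooth.comp (hρ.contMDiff_orbit x)
  refine ⟨hs.comp hC.smooth, fun X y ↦ ?_⟩
  have h := ((hs.mdifferentiableAt (by simp)).hasMFDerivAt (x := C y)).comp y
    ((hC.smooth.mdifferentiableAt (by simp)).hasMFDerivAt)
  have h2 : mfderiv 𝓘(ℝ, E) 𝓘(ℝ, F) (fun y ↦ C (ρ x (C y))) y (ζ.field X y) =
      mfderiv 𝓘(ℝ, F) 𝓘(ℝ, F) (fun h ↦ C (ρ x h)) (C y)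
        (mfderiv 𝓘(ℝ, E) 𝓘(ℝ, F) C y (ζ.field X y)) :=
    congrArg (fun T : E →L[ℝ] F ↦ T (ζ.field X y)) h.mfderiv
  rw [h2, hC.related]
  exact hC.mfderiv_comp_orbit hρ x (C y) X

/-- For an integrated action, the orbit map is a left inverse of the developing map. -/
theorem IsEquivariant.orbit_apply [T2Space M] [ConnectedSpace M] {C : M → G}
    (hC : ζ.IsEquivariant e C) (htrans : ζ.IsTransitive)
    (hloc : IsLocalDiffeomorph 𝓘(ℝ, E) 𝓘(ℝ, F) ∞ C) (hρ : ζ.IsIntegratedBy e ρ) {x : M}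
    (hx : C x = 1) (y : M) : ρ x (C y) = y := by
  have hcomp : (fun y ↦ C (ρ x (C y))) = C :=
    (hC.comp_orbit hρ x).eq_of_apply_eq htrans hC (x := x) (by simp [hx, hρ.act_one])
  have hcont : Continuous fun y ↦ ρ x (C y) :=
    (hρ.contMDiff_orbit x).continuous.comp hC.smooth.continuous
  -- Closed because `M` is Hausdorff; open because `C` is locally injective and takes the same value
  -- at `ρ x (C w)` and `w`.
  have hclopen : IsClopen {y | ρ x (C y) = y} := by
    refine ⟨isClosed_eq hcont continuous_id, isOpen_iff_mem_nhds.2 fun z hz ↦ ?_⟩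
    obtain ⟨Φ, hzΦ, heq⟩ := hloc z
    have hz₀ : ρ x (C z) = z := hz
    have hz' : ρ x (C z) ∈ Φ.source := by rwa [hz₀]
    filter_upwards [Φ.open_source.mem_nhds hzΦ,
      hcont.continuousAt.preimage_mem_nhds (Φ.open_source.mem_nhds hz')] with w h1 h2
    refine Φ.injOn h2 h1 ?_
    exact (heq h2).symm.trans ((congrFun hcomp w).trans (heq h1))
  have := hclopen.eq_univ ⟨x, by simp [hx, hρ.act_one]⟩
  exact this.ge (mem_univ y)

/-- Both `h ↦ C (ρ x h)` and the identity of `G` preserve every `L_X`, so they have the same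
logarithmic derivative; they agree at `1`, and `G` is connected. -/
theorem IsEquivariant.apply_orbit [FiniteDimensional ℝ F] [ConnectedSpace G] {C : M → G}
    (hC : ζ.IsEquivariant e C) (hρ : ζ.IsIntegratedBy e ρ) {x : M} (hx : C x = 1) (g : G) :
    C (ρ x g) = g := by
  have : IsManifold 𝓘(ℝ, F) 1 G := IsManifold.of_le (n := ∞) (by simp)
  have hsurj : ∀ h : G, Function.Surjective fun X : 𝔤 ↦ mulInvariantVectorField (e X) h := fun h ↦
    (mulInvariantVectorField_bijective (F := F) h).2.comp e.surjective
  have hs : ContMDiff 𝓘(ℝ, F) 𝓘(ℝ, F) ∞ fun h ↦ C (ρ x h) :=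
    hC.smooth.comp (hρ.contMDiff_orbit x)
  refine congrFun (eq_of_hasLogDerivAt (V := F) (F := F) (f₁ := fun h ↦ C (ρ x h)) (f₂ := id)
    (α := fun h v ↦ e (Function.surjInv (hsurj h) v))
    (fun h ↦ ⟨hs.mdifferentiableAt (by simp), fun v ↦ ?_⟩)
    (fun h ↦ ⟨mdifferentiableAt_id, fun v ↦ ?_⟩) (n := 1) (by simp [hρ.act_one, hx])) g
  · have h1 := hC.mfderiv_comp_orbit hρ x h (Function.surjInv (hsurj h) v)
    have h2 : mulInvariantVectorField (e (Function.surjInv (hsurj h) v)) h = v :=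
      Function.surjInv_eq (hsurj h) v
    rwa [h2] at h1
  · rw [mfderiv_id]
    exact (Function.surjInv_eq (hsurj h) v).symm

end Integrated

end LieAlgebraAction

end Development

/-! ### Assembly of the theorem -/

theorem proposition5p2 {𝔤 : Type*} [LieRing 𝔤] [LieAlgebra ℝ 𝔤] [FiniteDimensional ℝ 𝔤]
    {E : Type*} [NormedAddCommGroup E] [NormedSpace ℝ E] [FiniteDimensional ℝ E]
    {M : Type*} [TopologicalSpace M] [T2Space M] [ChartedSpace E M] [IsManifold 𝓘(ℝ, E) ∞ M]
    [SimplyConnectedSpace M]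
    {F : Type*} [NormedAddCommGroup F] [NormedSpace ℝ F] [FiniteDimensional ℝ F] [CompleteSpace F]
    {G : Type*} [TopologicalSpace G] [ChartedSpace F G] [Group G] [LieGroup 𝓘(ℝ, F) ∞ G]
    (e : 𝔤 ≃ₗ⁅ℝ⁆ GroupLieAlgebra 𝓘(ℝ, F) G)
    (ζ : LieAlgebraAction 𝔤 E M) (hfree : ζ.IsFree) (htrans : ζ.IsTransitive) (x : M) :
    IsOpen (ζ.developingDomain e x) ∧
    ∃ C : M → G,
      (ζ.IsEquivariant e C ∧ C x = 1 ∧ (∀ y, C y ∈ ζ.developingDomain e x) ∧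
        IsLocalDiffeomorph 𝓘(ℝ, E) 𝓘(ℝ, F) ∞ C) ∧
      (∀ C' : M → G, ζ.IsEquivariant e C' → C' x = 1 → C' = C) ∧
      ((∃ ρ : M → G → M, ζ.IsIntegratedBy e ρ) →
        (∃ Φ : PartialDiffeomorph 𝓘(ℝ, E) 𝓘(ℝ, F) M G ∞,
          Φ.source = Set.univ ∧ Φ.target = ζ.developingDomain e x ∧ ∀ y, Φ y = C y) ∧
        (ConnectedSpace G → ζ.developingDomain e x = Set.univ)) := by
  obtain ⟨C, hC, hx⟩ := ζ.exists_isEquivariant e hfree htrans x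
  have hloc := hC.isLocalDiffeomorph hfree htrans
  have hrange := hC.developingDomain_eq_range hfree htrans hx
  have hopen : IsOpen (ζ.developingDomain e x) := hrange ▸ hloc.isOpen_range
  refine ⟨hopen, C, ⟨hC, hx, fun y ↦ hrange ▸ Set.mem_range_self y, hloc⟩,
    fun C' hC' hx' ↦ hC'.eq_of_apply_eq htrans hC (hx'.trans hx.symm), ?_⟩
  rintro ⟨ρ, hρ⟩
  have hinv := hC.orbit_apply htrans hloc hρ hx
  -- The inverse is the orbit map of `x`, smooth on all of `G`. Being a left inverse of `C`, it is
  -- also a right inverse on the range of `C`, which is `W_x`.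
  refine ⟨⟨{ toFun := C
             invFun := ρ x
             source := Set.univ
             target := ζ.developingDomain e x
             map_source' := fun y _ ↦ hrange ▸ Set.mem_range_self y
             map_target' := fun _ _ ↦ Set.mem_univ _
             left_inv' := fun y _ ↦ hinv y
             right_inv' := fun g hg ↦ ?_
             open_source := isOpen_univ
             open_target := hopen
             contMDiffOn_toFun := hC.smooth.contMDiffOn
             contMDiffOn_invFun := (hρ.contMDiff_orbit x).contMDiffOn }, rfl, rfl, fun _ ↦ rfl⟩,
    fun _ ↦ ?_⟩
  · rw [hrange] at hg
    obtain ⟨y, rfl⟩ := hg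
    rw [hinv]
  · rw [hrange]
    exact Set.range_eq_univ.2 fun g ↦ ⟨ρ x g, hC.apply_orbit hρ hx g⟩
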